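/- **Setting.** Distributions on $\{0,1\}^n$ are compared by the Hellinger distance $d_H(P,Q)=\frac1{\sqrt2}\big(\sum_x(\sqrt{P(x)}-\sqrt{Q(x)})^2\big)^{1/2}$. For a distribution $\mathcal D$ on $\{0,1\}^n$ let $|\psi_{\mathcal D}\rangle=\sum_x\sqrt{\mathcal D(x)}\,|x\rangle$. A circuit $C$ on $n$ qubits is a sequence of $T$ unitary gates, each acting on at most $k$ qubits; $\mathcal D_C(x)=|\langle x|U_C|0^n\rangle|^2$, and $\Phi_C$ is the diagonal unitary $|x\rangle\mapsto e^{i\arg\langle x|U_C|0^n\rangle}|x\rangle$ (with $\arg 0=0$), which is the identity if $U_C|0^n\rangle=|\psi_{\mathcal D_C}\rangle$. The comparison circuit $G$ of $C$ acts on registers out ($1$ qubit), adv ($n$ qubits), aux ($n$ qubits) and consists of $T'=n+T+3$ gates $G_1,\dots,G_{T'}$: the gates of $C$ on aux, a Hadamard on out, the $n$ swaps of the $i$-th qubits of adv and aux controlled by out, a Hadamard on out, a NOT on out. With $|j\rangle_{\rm clock}=|1^j0^{T'-j}\rangle$ on $T'$ further qubits, the history state of an $n$-qubit state $|\psi\rangle$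 is $$|\phi_\psi\rangle=\frac1{\sqrt{T'+1}}\sum_{j=0}^{T'}|j\rangle_{\rm clock}\otimes G_j\cdots G_1|0\rangle_{\rm out}|\psi\rangle_{\rm adv}|0^n\rangle_{\rm aux}.$$ In a receive-and-measure protocol with $N$ rounds the prover sends, in each round, a fresh copy of one and the same (possibly mixed) state $\rho$ on the $n'=2n+1+T'$ qubits (clock, out, adv, aux), one qubit at a time. The verifier tosses classical coins, independently in each round, measures each arriving qubit separately in a Pauli basis ($X$, $Y$ or $Z$) determined by the coins, and keeps only classical information; so it needs quantum memory for one qubit only. After the last round it computes from its classical record either $\bot$ (reject) or a finite sequence $S$ of elements of $\{0,1\}^n$ (accept). "$S\sim_{\rm i.i.d.}\mathcal D^{|S|}$" means: for every $m$, given that the verifier accepts with $|S|=m$, the sequence $S$ has law $\mathcal D^{m}$. For a state $\rho$ let $q(\rho)$ be the probability that measuring all qubits of $\rho$ in the $Z$ basis gives only zeros in clock, out and aux, and, if $q(\rho)>0$, let $\mathcal D^A$ be the law of the content of adv conditioned on this event. **Theorem (Constant Memory Quantum Verifier).** There are absolute constants $\eta_0,c_D,c_S>0$ and, for every $k$, a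 constant $c_N>0$ depending only on $k$, such that the following holds. For every $n\ge1$, every circuit $C$ on $n$ qubits with $T\ge0$ gates, each acting on at most $k$ qubits, every $\delta\in(0,\frac13)$, every integer $K\ge1$ and every $\eta\in(0,\eta_0]$ there is a receive-and-measure protocol as above with $$N\le c_N\,\frac{K\,(n^5+n^2T^3+T^5)}{\eta^4}\,\log(1/\delta)$$ rounds, in which each message has $n'\le 7(n+T)$ qubits, such that: * (Completeness) For every distribution $\mathcal D$ on $\{0,1\}^n$ with $d_H(\mathcal D,\mathcal D_C)\le\eta$: if the prover sends in each round the history state of $\Phi_C|\psi_{\mathcal D}\rangle$, then with probability at least $1-\delta$ the verifier accepts with $|S|\ge c_S K$, and $S\sim_{\rm i.i.d.}\mathcal D^{|S|}$. * (Soundness) For every density matrix $\rho$ on $n'$ qubits: if the verifier accepts with probability at least $\frac23$ when the prover sends $\rho$ in each round, then $q(\rho)>0$, $S\sim_{\rm i.i.d.}(\mathcal D^A)^{|S|}$ and $d_H(\mathcal D_C,\mathcal D^A)\le c_D\,\eta^{1/4}$. -/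

import Mathlib

open scoped BigOperators Matrix ComplexOrder

noncomputable section

namespace QVerifier

/-! Qubits labelled by a finite type `ι`: the computational basis is `ι → Bool`, state vectors are
functions `(ι → Bool) → ℂ`, operators are matrices over `ι → Bool`. -/

/-- A gate on the qubits `ι`: a unitary on `arity` qubits together with the (distinct) wires
to which it is applied. -/
structure Gate (ι : Type) where
  arity : ℕ
  wires : Fin arity ↪ ι
  op : Matrix.unitaryGroup (Fin arity → Bool) ℂ

/-- The same gate applied to relabelled qubits. -/
def Gate.map {ι κ : Type} (f : ι ↪ κ) (g : Gate ι) : Gate κ where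
  arity := g.arity
  wires := g.wires.trans f
  op := g.op

open Classical in
/-- The operator of a gate on all the qubits: `op` on its wires, tensored with the identity. -/
def Gate.toMatrix {ι : Type} (g : Gate ι) : Matrix (ι → Bool) (ι → Bool) ℂ :=
  fun x y =>
    if ∀ i, i ∉ Set.range g.wires → x i = y i then
      (g.op : Matrix (Fin g.arity → Bool) (Fin g.arity → Bool) ℂ)
        (fun a => x (g.wires a)) (fun a => y (g.wires a))
    else 0

/-- Apply a list of operators to a vector, the head of the list first. -/
def applyAll {B : Type} [Fintype B] (l : List (Matrix B B ℂ)) (v : B → ℂ) : B → ℂ :=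
  l.foldl (fun w A => A *ᵥ w) v

/-- The output state `U_C |0…0⟩` of a circuit `C` on `n` qubits (a list of gates, the first gate
at the head). -/
def circuitState {n : ℕ} (C : List (Gate (Fin n))) : (Fin n → Bool) → ℂ :=
  applyAll (C.map Gate.toMatrix) (Pi.single (fun _ => false) 1)

/-- `D_C`: the distribution of the outcome when `U_C |0…0⟩` is measured in the `Z` basis. -/
def circuitDist {n : ℕ} (C : List (Gate (Fin n))) (x : Fin n → Bool) : ℝ :=
  ‖circuitState C x‖ ^ 2

/-- Hellinger distance of two distributions on a finite set. -/
def hellinger {B : Type} [Fintype B] (P Q : B → ℝ) : ℝ :=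
  (1 / √2) * √(∑ x, (√(P x) - √(Q x)) ^ 2)

/-- The quantum sample `|ψ_D⟩ = ∑ₓ √D(x) |x⟩`. -/
def qsample {n : ℕ} (D : (Fin n → Bool) → ℝ) : (Fin n → Bool) → ℂ :=
  fun x => ((√(D x) : ℝ) : ℂ)

/-- The diagonal unitary `|x⟩ ↦ e^{iθ(x)} |x⟩`, with `θ(x)` the argument of the amplitude of `x` in
`U_C |0…0⟩` (`θ(x) = 0` if that amplitude is zero). It depends only on `C`, does not change outcome
probabilities in the `Z` basis, and is the identity when `U_C |0…0⟩ = |ψ_{D_C}⟩`. -/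
def alignPhase {n : ℕ} (C : List (Gate (Fin n))) (ψ : (Fin n → Bool) → ℂ) :
    (Fin n → Bool) → ℂ :=
  fun x => Complex.exp (((circuitState C x).arg : ℂ) * Complex.I) * ψ x

/-! ### The comparison circuit and its history state -/

/-- Qubits of the comparison circuit: `out` (one qubit), `adv` (`n` qubits), `aux` (`n` qubits). -/
abbrev CompQubit (n : ℕ) : Type := Unit ⊕ (Fin n ⊕ Fin n)

abbrev CompQubit.out {n : ℕ} : CompQubit n := Sum.inl ()

abbrev CompQubit.adv {n : ℕ} (i : Fin n) : CompQubit n := Sum.inr (Sum.inl i)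

abbrev CompQubit.aux {n : ℕ} (i : Fin n) : CompQubit n := Sum.inr (Sum.inr i)

/-- The embedding of the `n` qubits of `C` as the `aux` register. -/
def auxEmb (n : ℕ) : Fin n ↪ CompQubit n :=
  ⟨CompQubit.aux, fun _ _ h => Sum.inr.inj (Sum.inr.inj h)⟩

open Classical in
/-- The Hadamard gate on the `out` qubit. -/
def hadamardOut (n : ℕ) : Matrix (CompQubit n → Bool) (CompQubit n → Bool) ℂ :=
  fun x y =>
    if ∀ i, i ≠ CompQubit.out → x i = y i then
      (1 / (√2 : ℝ) : ℂ) * (if x CompQubit.out && y CompQubit.out then -1 else 1)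
    else 0

/-- The NOT gate on the `out` qubit. -/
def notOut (n : ℕ) : Matrix (CompQubit n → Bool) (CompQubit n → Bool) ℂ :=
  fun x y => if x = Function.update y CompQubit.out (!y CompQubit.out) then 1 else 0

/-- The gate that swaps `adv i` and `aux i`, controlled by the `out` qubit. -/
def cswap {n : ℕ} (i : Fin n) : Matrix (CompQubit n → Bool) (CompQubit n → Bool) ℂ :=
  fun x y =>
    if x = (if y CompQubit.out then
        y ∘ Equiv.swap (CompQubit.adv i) (CompQubit.aux i) else y) then 1 else 0

/-- The gates of the comparison circuit, in order of application: `C` on `aux`, a Hadamard on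
`out`, the `n` controlled swaps, a Hadamard and a NOT on `out`. These are `T + n + 3` gates. -/
def comparisonGates {n : ℕ} (C : List (Gate (Fin n))) :
    List (Matrix (CompQubit n → Bool) (CompQubit n → Bool) ℂ) :=
  C.map (fun g => (g.map (auxEmb n)).toMatrix) ++ [hadamardOut n] ++ List.ofFn (fun i => cswap i) ++
    [hadamardOut n, notOut n]

/-- A basis state with the content of `adv` prescribed and with `out` and `aux` all zero. -/
def compInput {n : ℕ} (x : Fin n → Bool) : CompQubit n → Bool :=
  Sum.elim (fun _ => false) (Sum.elim x (fun _ => false))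

open Classical in
/-- The input `|0⟩_out |ψ⟩_adv |0…0⟩_aux`. -/
def inputState {n : ℕ} (ψ : (Fin n → Bool) → ℂ) : (CompQubit n → Bool) → ℂ :=
  fun y => if y = compInput (fun i => y (CompQubit.adv i))
    then ψ (fun i => y (CompQubit.adv i)) else 0

/-- Qubits of one message of the prover: `T' = n + T + 3` clock qubits and the qubits
of the comparison circuit. -/
abbrev MsgQubit (n T : ℕ) : Type := Fin (n + T + 3) ⊕ CompQubit n

/-- The unary clock value `j`: `j` ones followed by zeros. -/
def unary (m j : ℕ) : Fin m → Bool := fun i => decide (i.val < j)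

/-- The history state `(T'+1)^{-1/2} ∑_{j=0}^{T'} |j⟩_clock ⊗ G_j ⋯ G_1 |0⟩|ψ⟩|0…0⟩` of the
comparison circuit on the input `ψ`. -/
def historyState {n : ℕ} (C : List (Gate (Fin n))) (ψ : (Fin n → Bool) → ℂ) :
    (MsgQubit n C.length → Bool) → ℂ :=
  fun z => (1 / (√((n + C.length + 3 : ℕ) + 1 : ℝ) : ℝ) : ℂ) *
    ∑ j ∈ Finset.range (n + C.length + 3 + 1),
      if (fun i => z (Sum.inl i)) = unary (n + C.length + 3) j then
        applyAll ((comparisonGates C).take j) (inputState ψ) (fun i => z (Sum.inr i))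
      else 0

/-- The density matrix `|φ⟩⟨φ|`. -/
def pureState {B : Type} (φ : B → ℂ) : Matrix B B ℂ := Matrix.vecMulVec φ (star φ)

/-- Density matrices: positive semidefinite of trace one. -/
def IsDensity {B : Type} [Fintype B] (ρ : Matrix B B ℂ) : Prop :=
  ρ.PosSemidef ∧ ρ.trace = 1

/-! ### Receive-and-measure protocols -/

/-- The bases in which the verifier may measure a single qubit. -/
inductive PauliBasis
  | X
  | Y
  | Z

/-- The basis vector that belongs to an outcome (`false` for the eigenvalue `+1`, `true` for `-1`),
given by its two coordinates. -/
def PauliBasis.vec : PauliBasis → Bool → Bool → ℂ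
  | .Z, b, c => if c = b then 1 else 0
  | .X, b, c => (1 / (√2 : ℝ) : ℂ) * (if c then (if b then -1 else 1) else 1)
  | .Y, b, c => (1 / (√2 : ℝ) : ℂ) * (if c then (if b then -Complex.I else Complex.I) else 1)

/-- The product basis vector for the outcomes `b` when qubit `i` is measured in basis `β i`. -/
def prodVec {ι : Type} [Fintype ι] (β : ι → PauliBasis) (b x : ι → Bool) : ℂ :=
  ∏ i, (β i).vec (b i) (x i)

/-- Born's rule: the probability of the outcomes `b` when the qubits of a system in state `ρ` are
measured one by one, qubit `i` in basis `β i`. -/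
def born {ι : Type} [Fintype ι] [DecidableEq ι] (ρ : Matrix (ι → Bool) (ι → Bool) ℂ)
    (β : ι → PauliBasis) (b : ι → Bool) : ℝ :=
  (star (prodVec β b) ⬝ᵥ ρ *ᵥ prodVec β b).re

/-- The verifier of a receive-and-measure protocol with message qubits `ι` and with samples in
`{0,1}^n`. In each round it tosses classical coins, receives the qubits of the message one at
a time, and measures each one separately on arrival in a Pauli basis determined by the coins; so it
never stores more than one qubit and all it keeps is classical. After the last round it computes
from the classical record either `none` (reject) or `some S` (accept, with the samples `S`). -/
structure Verifier (ι : Type) (n : ℕ) where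
  rounds : ℕ
  Coin : Type
  fintypeCoin : Fintype Coin
  coinDist : Coin → ℝ
  coinDist_mem : coinDist ∈ stdSimplex ℝ Coin
  basis : Coin → ι → PauliBasis
  output : (Fin rounds → Coin × (ι → Bool)) → Option (List (Fin n → Bool))

attribute [instance] Verifier.fintypeCoin

/-- The probability that the output of the verifier lies in `E`, when the prover sends a fresh copy
of the state `ρ` in every round. -/
def Verifier.prob {ι : Type} [Fintype ι] [DecidableEq ι] {n : ℕ} (V : Verifier ι n)
    (ρ : Matrix (ι → Bool) (ι → Bool) ℂ) (E : Set (Option (List (Fin n → Bool)))) : ℝ :=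
  ∑ τ : Fin V.rounds → V.Coin × (ι → Bool),
    Set.indicator {τ | V.output τ ∈ E}
      (fun τ => ∏ r, V.coinDist (τ r).1 * born ρ (V.basis (τ r).1) (τ r).2) τ

/-- The samples are i.i.d. from `D`: given that the verifier accepts with `m` samples,
their joint law is the product law `D^m`, for every `m`. -/
def Verifier.SamplesIID {ι : Type} [Fintype ι] [DecidableEq ι] {n : ℕ} (V : Verifier ι n)
    (ρ : Matrix (ι → Bool) (ι → Bool) ℂ) (D : (Fin n → Bool) → ℝ) : Prop :=
  ∀ S : List (Fin n → Bool),
    V.prob ρ {some S} =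
      V.prob ρ {o | ∃ S' : List (Fin n → Bool), o = some S' ∧ S'.length = S.length} *
        (S.map D).prod

/-! ### The distribution `D^A` of a message -/

/-- The probability that measuring all the qubits of `ρ` in the `Z` basis gives zeros in `clock`,
`out` and `aux`, and `x` in `adv`. -/
def advWeight {n T : ℕ} (ρ : Matrix (MsgQubit n T → Bool) (MsgQubit n T → Bool) ℂ)
    (x : Fin n → Bool) : ℝ :=
  (ρ (Sum.elim (fun _ => false) (compInput x)) (Sum.elim (fun _ => false) (compInput x))).re

/-- The probability that `clock`, `out` and `aux` are all measured to be zero. -/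
def advProb {n T : ℕ} (ρ : Matrix (MsgQubit n T → Bool) (MsgQubit n T → Bool) ℂ) : ℝ :=
  ∑ x, advWeight ρ x

/-- `D^A`: the law of the content of `adv` when all the qubits of `ρ` are measured in the `Z` basis,
conditioned on `clock`, `out` and `aux` being all zero. -/
def advDist {n T : ℕ} (ρ : Matrix (MsgQubit n T → Bool) (MsgQubit n T → Bool) ℂ)
    (x : Fin n → Bool) : ℝ :=
  advWeight ρ x / advProb ρ

end QVerifier

end

/-! The history states of accepting runs of the comparison circuit have zero energy with respect to
its Feynman–Kitaev Hamiltonian, and the history state of an honest prover has energy at most `s`,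
of the order `(η / T') ^ 2`. The diagonal terms of the Hamiltonian are read off from measurements in
the `Z` basis, and the propagation term of a gate has an unbiased estimate from measurements of
single qubits in Pauli bases: the clock qubits except one in the `Z` basis, and that one and the
qubits of the gate in random bases. The size of the estimate is exponential in the locality of the
gate only, so by Bernstein's inequality the average over the rounds is close to the energy.

Conversely, decompose a message of energy at most `3 * s` into an ensemble of pure states. The
propagation terms force the parts of a pure state at successive clock values to be related by the
gates, so its last part is close to the output of the comparison circuit on its first part. That
output is mostly accepted, and for a swap test this means that the content of `adv` is close to the
output state of `C`, hence so are the laws of the outcomes.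

The samples are the contents of `adv` in the rounds in which all qubits are measured in the `Z`
basis and `clock`, `out` and `aux` are zero. Such an outcome contributes exactly zero to the
estimate whatever the content of `adv`, so acceptance depends on the samples through their positions
only and the samples remain independent when one conditions on it. -/

noncomputable section

namespace QVerifier

/-! ### Independent rounds over a finite probability space -/

section FiniteProbability

variable {Ω : Type*}

/-- The product law of `N` independent outcomes with law `p`. -/
def iidWeight (p : Ω → ℝ) (N : ℕ) (τ : Fin N → Ω) : ℝ :=
  ∏ r, p (τ r)

theorem iidWeight_nonneg {p : Ω → ℝ} (hp : 0 ≤ p) (N : ℕ) : 0 ≤ iidWeight p N :=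
  fun τ => Finset.prod_nonneg fun r _ => hp (τ r)

variable [Fintype Ω] {p : Ω → ℝ}

/-- The probability of an event `E` under the weights `p` on a finite set. -/
def eventProb (p : Ω → ℝ) (E : Set Ω) : ℝ :=
  ∑ ω, E.indicator p ω

theorem eventProb_eq_sum_ite (p : Ω → ℝ) (P : Ω → Prop) [DecidablePred P] :
    eventProb p {ω | P ω} = ∑ ω, if P ω then p ω else 0 :=
  Finset.sum_congr rfl fun ω _ => by
    simp only [Set.indicator_apply, Set.mem_ofPred_eq]

@[simp]
theorem eventProb_empty (p : Ω → ℝ) : eventProb p ∅ = 0 := by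
  simp [eventProb]

theorem eventProb_mono (hp : 0 ≤ p) {E F : Set Ω} (h : E ⊆ F) : eventProb p E ≤ eventProb p F :=
  Finset.sum_le_sum fun ω _ => Set.indicator_le_indicator_of_subset h hp ω

theorem eventProb_union_le (hp : 0 ≤ p) (E F : Set Ω) :
    eventProb p (E ∪ F) ≤ eventProb p E + eventProb p F := by
  rw [eventProb, eventProb, eventProb, ← Finset.sum_add_distrib]
  refine Finset.sum_le_sum fun ω _ => ?_
  rw [← Set.indicator_union_add_inter_apply]
  exact le_add_of_nonneg_right (Set.indicator_nonneg (fun ω _ => hp ω) ω)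

theorem eventProb_compl (hp : ∑ ω, p ω = 1) (E : Set Ω) : eventProb p Eᶜ = 1 - eventProb p E := by
  rw [eventProb, eventProb, ← hp, ← Finset.sum_sub_distrib]
  exact Finset.sum_congr rfl fun ω _ => by rw [Set.indicator_compl, Pi.sub_apply]

theorem sum_iidWeight_mul_prod (p f : Ω → ℝ) (N : ℕ) :
    ∑ τ, iidWeight p N τ * ∏ r, f (τ r) = (∑ ω, p ω * f ω) ^ N := by
  simp only [iidWeight, ← Finset.prod_mul_distrib, Fintype.sum_pow]

theorem sum_iidWeight (hp : ∑ ω, p ω = 1) (N : ℕ) : ∑ τ, iidWeight p N τ = 1 := by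
  simpa [hp] using sum_iidWeight_mul_prod p (fun _ => 1) N

theorem sum_mul_exp_le {X : Ω → ℝ} (hp : p ∈ stdSimplex ℝ Ω) {t V : ℝ}
    (ht : ∀ ω, |t * X ω| ≤ 1) (hV : ∑ ω, p ω * X ω ^ 2 ≤ V) :
    ∑ ω, p ω * Real.exp (t * X ω) ≤ Real.exp (t * ∑ ω, p ω * X ω + t ^ 2 * V) :=
  calc ∑ ω, p ω * Real.exp (t * X ω)
      ≤ ∑ ω, p ω * (1 + t * X ω + (t * X ω) ^ 2) := by
        refine Finset.sum_le_sum fun ω _ => mul_le_mul_of_nonneg_left ?_ (hp.1 ω)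
        linarith [(abs_le.1 (Real.abs_exp_sub_one_sub_id_le (ht ω))).2]
    _ = ∑ ω, (p ω + t * (p ω * X ω) + t ^ 2 * (p ω * X ω ^ 2)) :=
        Finset.sum_congr rfl fun ω _ => by ring
    _ = 1 + t * ∑ ω, p ω * X ω + t ^ 2 * ∑ ω, p ω * X ω ^ 2 := by
        rw [Finset.sum_add_distrib, Finset.sum_add_distrib, hp.2, Finset.mul_sum, Finset.mul_sum]
    _ ≤ (t * ∑ ω, p ω * X ω + t ^ 2 * V) + 1 := by
        linarith [mul_le_mul_of_nonneg_left hV (sq_nonneg t)]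
    _ ≤ _ := Real.add_one_le_exp _

theorem eventProb_sum_ge_le_exp (hp : 0 ≤ p) (X : Ω → ℝ) {t : ℝ} (ht : 0 ≤ t) (N : ℕ) (a : ℝ) :
    eventProb (iidWeight p N) {τ | a ≤ ∑ r, X (τ r)}
      ≤ Real.exp (-(t * a)) * (∑ ω, p ω * Real.exp (t * X ω)) ^ N := by
  rw [← sum_iidWeight_mul_prod, Finset.mul_sum]
  refine Finset.sum_le_sum fun τ _ => ?_
  rw [← Real.exp_sum, ← Finset.mul_sum, mul_left_comm, ← Real.exp_add]
  refine Set.indicator_apply_le' (fun h => ?_) fun _ =>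
    mul_nonneg (iidWeight_nonneg hp N τ) (Real.exp_pos _).le
  refine le_mul_of_one_le_right (iidWeight_nonneg hp N τ) (Real.one_le_exp ?_)
  linarith [mul_le_mul_of_nonneg_left (show a ≤ ∑ r, X (τ r) from h) ht]

/-- Bernstein's inequality, with the second moment in place of the variance. -/
theorem eventProb_sum_ge_le {X : Ω → ℝ} (hp : p ∈ stdSimplex ℝ Ω) {R V s μ : ℝ}
    (hR : ∀ ω, |X ω| ≤ R) (hV : ∑ ω, p ω * X ω ^ 2 ≤ V) (hV0 : 0 < V) (hs : 0 ≤ s)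
    (hsR : s * R ≤ 2 * V) (hμ : ∑ ω, p ω * X ω ≤ μ) (N : ℕ) :
    eventProb (iidWeight p N) {τ | N * (μ + s) ≤ ∑ r, X (τ r)}
      ≤ Real.exp (-(N * (s ^ 2 / (4 * V)))) := by
  set t := s / (2 * V) with ht
  have ht0 : 0 ≤ t := by positivity
  have htX (ω : Ω) : |t * X ω| ≤ 1 := by
    rw [abs_mul, abs_of_nonneg ht0, ht, div_mul_eq_mul_div, div_le_one (by positivity)]
    exact (mul_le_mul_of_nonneg_left (hR ω) hs).trans hsR
  calc eventProb (iidWeight p N) {τ | N * (μ + s) ≤ ∑ r, X (τ r)}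
      ≤ Real.exp (-(t * (N * (μ + s)))) * (∑ ω, p ω * Real.exp (t * X ω)) ^ N :=
        eventProb_sum_ge_le_exp hp.1 X ht0 N _
    _ ≤ Real.exp (-(t * (N * (μ + s)))) * Real.exp (t * μ + t ^ 2 * V) ^ N := by
        gcongr
        · exact Finset.sum_nonneg fun ω _ => mul_nonneg (hp.1 ω) (Real.exp_pos _).le
        · exact (sum_mul_exp_le hp htX hV).trans (Real.exp_le_exp.2 (by gcongr))
    _ = _ := by
        rw [← Real.exp_nat_mul, ← Real.exp_add, ht]
        congr 1
        field_simp
        ring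

theorem eventProb_sum_le_le {X : Ω → ℝ} (hp : p ∈ stdSimplex ℝ Ω) {R V s μ : ℝ}
    (hR : ∀ ω, |X ω| ≤ R) (hV : ∑ ω, p ω * X ω ^ 2 ≤ V) (hV0 : 0 < V) (hs : 0 ≤ s)
    (hsR : s * R ≤ 2 * V) (hμ : μ ≤ ∑ ω, p ω * X ω) (N : ℕ) :
    eventProb (iidWeight p N) {τ | ∑ r, X (τ r) ≤ N * (μ - s)}
      ≤ Real.exp (-(N * (s ^ 2 / (4 * V)))) := by
  have hneg : {τ : Fin N → Ω | ∑ r, X (τ r) ≤ N * (μ - s)}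
      = {τ | N * (-μ + s) ≤ ∑ r, -X (τ r)} := by
    ext τ
    rw [Set.mem_ofPred_eq, Set.mem_ofPred_eq, Finset.sum_neg_distrib, ← neg_le_neg_iff]
    ring_nf
  rw [hneg]
  exact eventProb_sum_ge_le (X := fun ω => -X ω) hp (by simpa using hR) (by simpa using hV) hV0
    hs hsR (by simpa using hμ) N

theorem eventProb_iidWeight_succ (p : Ω → ℝ) (N : ℕ) (E : Set (Fin (N + 1) → Ω)) :
    eventProb (iidWeight p (N + 1)) E
      = ∑ ω, p ω * eventProb (iidWeight p N) {τ | Fin.cons ω τ ∈ E} := by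
  rw [eventProb, ← (Fin.consEquiv fun _ => Ω).sum_comp, Fintype.sum_prod_type]
  refine Finset.sum_congr rfl fun ω _ => ?_
  rw [eventProb, Finset.mul_sum]
  refine Finset.sum_congr rfl fun τ _ => ?_
  classical
  simp only [Set.indicator_apply, Set.mem_ofPred_eq, Fin.consEquiv_apply, mul_ite, mul_zero,
    iidWeight, Fin.prod_univ_succ, Fin.cons_zero, Fin.cons_succ]
  rfl

end FiniteProbability

/-! ### Samples extracted from independent rounds -/

section Samples

variable {Ω B R : Type*}

/-- The samples in a record `τ` of `N` rounds, if the outcome `ω` of a round gives the sample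
`samp ω`, or none. -/
def samples (samp : Ω → Option B) {N : ℕ} (τ : Fin N → Ω) : List B :=
  (List.ofFn τ).filterMap samp

theorem samples_cons (samp : Ω → Option B) {N : ℕ} (ω : Ω) (τ : Fin N → Ω) :
    samples samp (Fin.cons ω τ : Fin (N + 1) → Ω) = (samp ω).toList ++ samples samp τ := by
  simp only [samples, List.ofFn_succ, Fin.cons_zero, Fin.cons_succ, List.filterMap_cons]
  cases samp ω <;> rfl

theorem length_samples (samp : Ω → Option B) {N : ℕ} (τ : Fin N → Ω) :
    (samples samp τ).length = ∑ r, (samp (τ r)).toList.length := by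
  induction N with
  | zero => rfl
  | succ N ih =>
    rw [← Fin.cons_self_tail τ, samples_cons, List.length_append, Fin.sum_univ_succ, ih]
    rfl

theorem eventProb_samples_succ [Fintype Ω] [AddCommMonoid R] (p : Ω → ℝ) (X : Ω → R)
    (samp : Ω → Option B) (N : ℕ) (A : Set R) (u : List B → Prop) :
    eventProb (iidWeight p (N + 1)) {τ | ∑ r, X (τ r) ∈ A ∧ u (samples samp τ)}
      = ∑ ω, p ω * eventProb (iidWeight p N)
          {τ | ∑ r, X (τ r) ∈ (X ω + ·) ⁻¹' A ∧ u ((samp ω).toList ++ samples samp τ)} := by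
  rw [eventProb_iidWeight_succ]
  refine Finset.sum_congr rfl fun ω _ => ?_
  simp only [Set.mem_ofPred_eq, Set.mem_preimage, samples_cons, Fin.sum_univ_succ, Fin.cons_zero,
    Fin.cons_succ]

/-- If the statistic `X` vanishes on the outcomes that give a sample, then the samples remain
independent with law `D` after conditioning on an event that depends only on `∑ r, X (τ r)`. -/
theorem eventProb_samples_eq [Fintype Ω] [AddCommMonoid R] {p : Ω → ℝ} {X : Ω → R}
    {samp : Ω → Option B} {D : B → ℝ} (hX : ∀ ω x, samp ω = some x → X ω = 0)
    (hD : ∀ x, eventProb p {ω | samp ω = some x} = eventProb p {ω | (samp ω).isSome} * D x)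
    (N : ℕ) (A : Set R) (S : List B) :
    eventProb (iidWeight p N) {τ | ∑ r, X (τ r) ∈ A ∧ samples samp τ = S}
      = eventProb (iidWeight p N) {τ | ∑ r, X (τ r) ∈ A ∧ (samples samp τ).length = S.length}
        * (S.map D).prod := by
  classical
  induction N generalizing A S with
  | zero => cases S <;> simp [samples, eventProb]
  | succ N ih =>
    cases S with
    | nil =>
      simp only [List.length_nil, List.length_eq_zero_iff, List.map_nil, List.prod_nil, mul_one]
    | cons y S =>
      rw [eventProb_samples_succ p X samp N A (· = y :: S),
        eventProb_samples_succ p X samp N A (fun l => l.length = (y :: S).length)]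
      set Q := eventProb (iidWeight p N)
        {τ | ∑ r, X (τ r) ∈ A ∧ (samples samp τ).length = S.length}
      have hround (ω : Ω) :
          p ω * eventProb (iidWeight p N)
              {τ | ∑ r, X (τ r) ∈ (X ω + ·) ⁻¹' A ∧ (samp ω).toList ++ samples samp τ = y :: S}
            = p ω * eventProb (iidWeight p N) {τ | ∑ r, X (τ r) ∈ (X ω + ·) ⁻¹' A ∧
                ((samp ω).toList ++ samples samp τ).length = (y :: S).length}
                * ((y :: S).map D).prod
              + ({ω | samp ω = some y}.indicator p ω
                - {ω | (samp ω).isSome}.indicator p ω * D y) * (Q * (S.map D).prod) := by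
        cases hω : samp ω with
        | none => simpa [hω, mul_assoc] using
            congrArg (p ω * ·) (ih ((X ω + ·) ⁻¹' A) (y :: S))
        | some x =>
          by_cases hxy : x = y
          · simp [hω, hxy, hX ω x hω, ih, Q]
            ring
          · simp [hω, hxy, hX ω x hω, Q]
            ring
      have hlaw : ∑ ω, ({ω | samp ω = some y}.indicator p ω
          - {ω | (samp ω).isSome}.indicator p ω * D y) = 0 := by
        rw [Finset.sum_sub_distrib, ← Finset.sum_mul]
        exact sub_eq_zero.2 (hD y)
      simp only [hround, Finset.sum_add_distrib, ← Finset.sum_mul, hlaw, zero_mul, add_zero]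

end Samples

section SampleCount

variable {Ω B : Type*} [Fintype Ω] {p : Ω → ℝ}

theorem eventProb_singleton (p : Ω → ℝ) (ω : Ω) : eventProb p {ω} = p ω := by
  rw [eventProb, Fintype.sum_eq_single ω]
  · exact Set.indicator_of_mem (Set.mem_singleton ω) p
  · exact fun ω' h => Set.indicator_of_notMem (Set.mem_singleton_iff.not.2 h) p

theorem eventProb_isSome [Fintype B] (p : Ω → ℝ) (samp : Ω → Option B) :
    eventProb p {ω | (samp ω).isSome} = ∑ x, eventProb p {ω | samp ω = some x} := by
  classical
  simp only [eventProb_eq_sum_ite]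
  rw [Finset.sum_comm]
  refine Finset.sum_congr rfl fun ω _ => ?_
  cases samp ω <;> simp

theorem eventProb_length_samples_le (hp : p ∈ stdSimplex ℝ Ω) (samp : Ω → Option B)
    (hq : 0 < eventProb p {ω | (samp ω).isSome}) (N : ℕ) :
    eventProb (iidWeight p N)
        {τ | ((samples samp τ).length : ℝ) ≤ N * (eventProb p {ω | (samp ω).isSome} / 2)} ≤
      Real.exp (-(N * (eventProb p {ω | (samp ω).isSome} / 16))) := by
  set q := eventProb p {ω | (samp ω).isSome} with hq_def
  have hcount : ∑ ω, p ω * ((samp ω).toList.length : ℝ) = q := by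
    rw [hq_def, eventProb_eq_sum_ite]
    refine Finset.sum_congr rfl fun ω _ => ?_
    cases samp ω <;> simp
  have hsq (ω : Ω) : ((samp ω).toList.length : ℝ) ^ 2 = (samp ω).toList.length := by
    cases samp ω <;> simp
  have habs (ω : Ω) : |((samp ω).toList.length : ℝ)| ≤ 1 := by
    cases samp ω <;> simp
  convert eventProb_sum_le_le hp habs (by simp only [hsq]; exact hcount.le) hq
    (half_pos hq).le (by linarith) hcount.ge N using 3
  · ext τ
    rw [length_samples, Nat.cast_sum, sub_half]
  · field_simp
    ring

end SampleCount

/-! ### Pauli measurements -/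

section OneQubit

instance : DecidableEq PauliBasis := fun p q => by
  cases p <;> cases q <;> first | exact isTrue rfl | exact isFalse nofun

instance : Fintype PauliBasis where
  elems := {.X, .Y, .Z}
  complete := fun p => by cases p <;> simp

theorem card_pauliBasis : Fintype.card PauliBasis = 3 := rfl

theorem sum_pauliBasis {M : Type*} [AddCommMonoid M] (f : PauliBasis → M) :
    ∑ p, f p = f .X + f .Y + f .Z := by
  have : (Finset.univ : Finset PauliBasis) = {.X, .Y, .Z} := rfl
  rw [this, Finset.sum_insert (by simp), Finset.sum_pair (by simp), add_assoc]

/-- The Pauli matrix whose eigenvectors form the given basis. -/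
def PauliBasis.matrix : PauliBasis → Matrix Bool Bool ℂ
  | .X => .of fun a a' => if a = a' then 0 else 1
  | .Y => .of fun a a' => if a = a' then 0 else if a then Complex.I else -Complex.I
  | .Z => .of fun a a' => if a = a' then (if a then -1 else 1) else 0

theorem pureState_vec (p : PauliBasis) (c : Bool) :
    pureState (p.vec c) = (1 / 2 : ℂ) • (1 + (if c then (-1 : ℂ) else 1) • p.matrix) := by
  have hsqrt : ((√2 : ℝ) : ℂ)⁻¹ * ((√2 : ℝ) : ℂ)⁻¹ = 1 / 2 := by
    rw [← mul_inv, ← Complex.ofReal_mul, Real.mul_self_sqrt (by norm_num)]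
    norm_num
  have hI := Complex.I_mul_I
  ext a a'
  cases p <;> cases c <;> cases a <;> cases a' <;>
    simp only [pureState, Matrix.vecMulVec_apply, PauliBasis.vec, PauliBasis.matrix, Pi.star_apply,
      Matrix.smul_apply, Matrix.add_apply, Matrix.one_apply, Matrix.of_apply, smul_eq_mul,
      RCLike.star_def, map_mul, map_neg, map_one, map_zero, map_div₀, Complex.conj_ofReal,
      Complex.conj_I, reduceCtorEq, if_true, if_false, Bool.false_eq_true] <;>
    first
    | ring1
    | linear_combination hsqrt
    | linear_combination -hsqrt
    | linear_combination Complex.I * hsqrt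
    | linear_combination -Complex.I * hsqrt
    | linear_combination (-Complex.I * Complex.I) * hsqrt - hI / 2

theorem sum_pureState_vec (p : PauliBasis) : ∑ c, pureState (p.vec c) = 1 := by
  simp only [pureState_vec, Fintype.sum_bool, ← smul_add]
  ext a a'
  simp
  ring

/-- The operator on one qubit whose expectation is that of the sum of `f p c` over the bases `p`,
where `c` is the outcome of a measurement in the basis `p`. -/
def qubitObservable (f : PauliBasis → Bool → ℂ) : Matrix Bool Bool ℂ :=
  ∑ p, ∑ c, f p c • pureState (p.vec c)

/-- The weight of the outcome `c` in the basis `p` in the expansion of the matrix unit `|a⟩⟨a'|` of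
one qubit into the projections onto Pauli eigenvectors (a classical shadow). -/
def shadowWeight (a a' : Bool) (p : PauliBasis) (c : Bool) : ℂ :=
  pureState (p.vec c) a' a - if a = a' then 1 / 3 else 0

theorem norm_shadowWeight_le (a a' : Bool) (p : PauliBasis) (c : Bool) :
    ‖shadowWeight a a' p c‖ ≤ 1 := by
  rw [shadowWeight, pureState_vec]
  cases p <;> cases c <;> cases a <;> cases a' <;> simp [PauliBasis.matrix] <;> norm_num

theorem qubitObservable_shadowWeight (a a' : Bool) :
    qubitObservable (shadowWeight a a') = Matrix.single a a' 1 := by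
  have hI := Complex.I_mul_I
  rw [qubitObservable, sum_pauliBasis]
  simp only [shadowWeight, pureState_vec, Fintype.sum_bool]
  ext x y
  cases a <;> cases a' <;> cases x <;> cases y <;>
    simp only [PauliBasis.matrix, Matrix.smul_apply, Matrix.add_apply, Matrix.one_apply,
      Matrix.of_apply, Matrix.single_apply, smul_eq_mul, reduceCtorEq, if_true, if_false,
      Bool.false_eq_true, and_true, and_false] <;>
    first
    | ring1
    | linear_combination hI / 2
    | linear_combination -hI / 2

theorem qubitObservable_const_third : qubitObservable (fun _ _ => 1 / 3) = 1 := by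
  simp only [qubitObservable, ← Finset.smul_sum, sum_pureState_vec, Finset.sum_const,
    Finset.card_univ, card_pauliBasis]
  rw [← Nat.cast_smul_eq_nsmul ℂ, smul_smul]
  norm_num

theorem qubitObservable_Z (d : Bool) :
    qubitObservable (fun p c => if p = .Z ∧ c = d then 1 else 0) = Matrix.single d d 1 := by
  rw [qubitObservable, sum_pauliBasis]
  simp only [pureState_vec, Fintype.sum_bool]
  ext x y
  cases d <;> cases x <;> cases y <;> simp [PauliBasis.matrix] <;> norm_num

end OneQubit

section ManyQubits

variable {κ : Type} [Fintype κ]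

theorem pureState_prodVec_apply (β : κ → PauliBasis) (b x y : κ → Bool) :
    pureState (prodVec β b) x y = ∏ i, pureState ((β i).vec (b i)) (x i) (y i) := by
  simp only [pureState, Matrix.vecMulVec_apply, prodVec, Pi.star_apply, star_prod,
    Finset.prod_mul_distrib]

theorem prod_one_apply (x y : κ → Bool) :
    ∏ i, (1 : Matrix Bool Bool ℂ) (x i) (y i) = (1 : Matrix (κ → Bool) (κ → Bool) ℂ) x y := by
  simp only [Matrix.one_apply, Fintype.prod_ite_zero, Finset.prod_const_one, funext_iff]

variable [DecidableEq κ]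

theorem sum_pureState_prodVec (β : κ → PauliBasis) : ∑ b, pureState (prodVec β b) = 1 := by
  ext x y
  rw [← prod_one_apply, Matrix.sum_apply]
  simp only [pureState_prodVec_apply]
  exact (Fintype.prod_sum fun i c => pureState ((β i).vec c) (x i) (y i)).symm.trans
    (Finset.prod_congr rfl fun i _ => by rw [← sum_pureState_vec (β i), Matrix.sum_apply])

variable {ρ : Matrix (κ → Bool) (κ → Bool) ℂ}

theorem ofReal_born (hρ : ρ.IsHermitian) (β : κ → PauliBasis) (b : κ → Bool) :
    (born ρ β b : ℂ) = (ρ * pureState (prodVec β b)).trace := by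
  rw [pureState, Matrix.mul_vecMulVec, Matrix.trace_vecMulVec, dotProduct_comm]
  exact Complex.ext (Complex.ofReal_re _)
    ((Complex.ofReal_im _).trans (hρ.im_star_dotProduct_mulVec_self _).symm)

theorem born_nonneg (hρ : ρ.PosSemidef) (β : κ → PauliBasis) (b : κ → Bool) : 0 ≤ born ρ β b :=
  hρ.re_dotProduct_nonneg (prodVec β b)

theorem sum_born (hρ : ρ.IsHermitian) (β : κ → PauliBasis) :
    ((∑ b, born ρ β b : ℝ) : ℂ) = ρ.trace := by
  simp only [Complex.ofReal_sum, ofReal_born hρ]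
  rw [← Matrix.trace_sum, ← Matrix.mul_sum, sum_pureState_prodVec, mul_one]

theorem born_Z (ρ : Matrix (κ → Bool) (κ → Bool) ℂ) (b : κ → Bool) :
    born ρ (fun _ => .Z) b = (ρ b b).re := by
  have hvec : prodVec (fun _ : κ => PauliBasis.Z) b = Pi.single b 1 := by
    ext x
    simp only [prodVec, PauliBasis.vec, Pi.single_apply, Fintype.prod_ite_zero, funext_iff,
      Finset.prod_const_one]
  rw [born, hvec, ← Pi.single_star, star_one, Matrix.mulVec_single_one, single_one_dotProduct,
    Matrix.col_apply]

/-- The operator whose expectation is that of the sum of `F β b` over the product bases `β`, where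
`b` are the outcomes of a measurement in the basis `β`. -/
def observable (F : (κ → PauliBasis) → (κ → Bool) → ℂ) : Matrix (κ → Bool) (κ → Bool) ℂ :=
  ∑ β, ∑ b, F β b • pureState (prodVec β b)

theorem sum_mul_born (hρ : ρ.IsHermitian) (F : (κ → PauliBasis) → (κ → Bool) → ℂ) :
    ∑ β, ∑ b, F β b * (born ρ β b : ℂ) = (ρ * observable F).trace := by
  simp only [ofReal_born hρ, observable, Matrix.mul_sum, Matrix.trace_sum, Matrix.mul_smul,
    Matrix.trace_smul, smul_eq_mul]

theorem observable_sum_mul {σ : Type*} [Fintype σ] (r : σ → ℂ)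
    (F : σ → (κ → PauliBasis) → (κ → Bool) → ℂ) :
    observable (fun β b => ∑ s, r s * F s β b) = ∑ s, r s • observable (F s) := by
  simp only [observable, Finset.sum_smul, mul_smul, Finset.smul_sum]
  rw [Finset.sum_congr rfl fun β _ => Finset.sum_comm, Finset.sum_comm]

theorem observable_prod_apply (f : κ → PauliBasis → Bool → ℂ) (x y : κ → Bool) :
    observable (fun β b => ∏ i, f i (β i) (b i)) x y
      = ∏ i, qubitObservable (f i) (x i) (y i) := by
  simp only [observable, qubitObservable, Matrix.sum_apply, Matrix.smul_apply, smul_eq_mul,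
    pureState_prodVec_apply, ← Finset.prod_mul_distrib, Fintype.prod_sum]

theorem observable_mul_apply {α : Type} [Fintype α] [DecidableEq α]
    (F : (α → PauliBasis) → (α → Bool) → ℂ) (F' : (κ → PauliBasis) → (κ → Bool) → ℂ)
    (x y : α ⊕ κ → Bool) :
    observable (fun β b => F (β ∘ Sum.inl) (b ∘ Sum.inl) * F' (β ∘ Sum.inr) (b ∘ Sum.inr)) x y
      = observable F (x ∘ Sum.inl) (y ∘ Sum.inl) * observable F' (x ∘ Sum.inr) (y ∘ Sum.inr) := by
  simp only [observable, Matrix.sum_apply, Matrix.smul_apply, smul_eq_mul, pureState_prodVec_apply,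
    Fintype.prod_sum_type, ← Fintype.sum_prod_type']
  rw [Fintype.sum_mul_sum, ← Fintype.sum_prod_type']
  let e (γ : Type) := Equiv.sumArrowEquivProdArrow α κ γ
  refine Fintype.sum_equiv (((e _).prodCongr (e _)).trans (Equiv.prodProdProdComm _ _ _ _)) _ _
    fun z => mul_mul_mul_comm _ _ _ _

end ManyQubits

/-! ### Gates and their shadow estimates -/

section Gates

variable {ι : Type}

/-- The unbiased estimate of the operator of a gate from the outcomes `b` of measurements in
uniformly random Pauli bases `β`. -/
def Gate.estimate (g : Gate ι) (β : ι → PauliBasis) (b : ι → Bool) : ℂ :=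
  ∑ s : (Fin g.arity → Bool) × (Fin g.arity → Bool), (g.op : Matrix _ _ ℂ) s.1 s.2 *
    ∏ l, 3 * shadowWeight (s.1 l) (s.2 l) (β (g.wires l)) (b (g.wires l))

theorem Gate.norm_estimate_le (g : Gate ι) (β : ι → PauliBasis) (b : ι → Bool) :
    ‖g.estimate β b‖ ≤ 12 ^ g.arity := by
  have hterm (a a' : Fin g.arity → Bool) : ‖(g.op : Matrix _ _ ℂ) a a' *
      ∏ l, 3 * shadowWeight (a l) (a' l) (β (g.wires l)) (b (g.wires l))‖ ≤ 3 ^ g.arity := by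
    have hprod : ∏ l, ‖3 * shadowWeight (a l) (a' l) (β (g.wires l)) (b (g.wires l))‖ ≤
        ∏ _l : Fin g.arity, (3 : ℝ) := by
      refine Finset.prod_le_prod (fun _ _ => norm_nonneg _) fun l _ => ?_
      rw [norm_mul, Complex.norm_ofNat]
      linarith [norm_shadowWeight_le (a l) (a' l) (β (g.wires l)) (b (g.wires l))]
    rw [norm_mul, norm_prod, ← one_mul (3 ^ g.arity : ℝ)]
    rw [Finset.prod_const, Finset.card_univ, Fintype.card_fin] at hprod
    gcongr
    exact entry_norm_bound_of_unitary g.op.2 a a'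
  calc ‖g.estimate β b‖
      ≤ ∑ _s : (Fin g.arity → Bool) × (Fin g.arity → Bool), (3 : ℝ) ^ g.arity :=
        norm_sum_le_of_le _ fun s _ => hterm s.1 s.2
    _ = (2 * 2 * 3) ^ g.arity := by simp [mul_pow]
    _ = 12 ^ g.arity := by norm_num

variable [Fintype ι] [DecidableEq ι]

theorem prod_extend {m : ℕ} {γ M : Type*} [CommMonoid M] (w : Fin m ↪ ι)
    (f : Fin m → γ) (g : ι → γ) (F : ι → γ → M) :
    ∏ i, F i (Function.extend w f g i)
      = (∏ l, F (w l) (f l)) * ∏ i ∈ (Finset.univ.map w)ᶜ, F i (g i) := by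
  rw [← Finset.prod_mul_prod_compl (Finset.univ.map w), Finset.prod_map]
  simp only [w.injective.extend_apply]
  congr 1
  refine Finset.prod_congr rfl fun i hi => ?_
  rw [Function.extend_apply' _ _ _ (by simpa using hi)]

open scoped Kronecker in
theorem Gate.toMatrix_mem_unitaryGroup (g : Gate ι) :
    g.toMatrix ∈ Matrix.unitaryGroup (ι → Bool) ℂ := by
  let e : (ι → Bool) ≃ (Fin g.arity → Bool) × ({i // i ∉ Set.range g.wires} → Bool) :=
    (Equiv.piEquivPiSubtypeProd (· ∈ Set.range g.wires) _).trans
      ((Equiv.arrowCongr (Equiv.ofInjective _ g.wires.injective).symm (Equiv.refl _)).prodCongr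
        (Equiv.refl _))
  have htensor : g.toMatrix = ((g.op : Matrix _ _ ℂ) ⊗ₖ 1).submatrix e e := by
    ext x y
    simp only [Gate.toMatrix, Matrix.submatrix_apply, Matrix.kroneckerMap_apply, Matrix.one_apply,
      funext_iff, Subtype.forall, mul_ite, mul_one, mul_zero]
    exact ite_congr rfl (fun _ => rfl) fun _ => rfl
  have hU := Matrix.kronecker_mem_unitary g.op.2
    (one_mem (Matrix.unitaryGroup ({i // i ∉ Set.range g.wires} → Bool) ℂ))
  rw [Matrix.mem_unitaryGroup_iff, Matrix.star_eq_conjTranspose] at hU ⊢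
  rw [htensor, Matrix.conjTranspose_submatrix, Matrix.submatrix_mul_equiv, hU,
    Matrix.submatrix_one_equiv]

theorem Gate.toMatrix_apply (g : Gate ι) (x y : ι → Bool) :
    g.toMatrix x y = (g.op : Matrix _ _ ℂ) (x ∘ g.wires) (y ∘ g.wires) *
      ∏ i ∈ (Finset.univ.map g.wires)ᶜ, (1 : Matrix Bool Bool ℂ) (x i) (y i) := by
  simp only [Gate.toMatrix, Matrix.one_apply, Finset.prod_ite_zero, Finset.prod_const_one,
    mul_ite, mul_one, mul_zero, Finset.mem_compl, Finset.mem_map, Finset.mem_univ, true_and,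
    Set.mem_range]
  exact if_congr Iff.rfl rfl rfl

theorem Gate.observable_estimate (g : Gate ι) :
    observable (fun β b => (∏ _i : ι, 1 / 3) * g.estimate β b) = g.toMatrix := by
  let f (s : (Fin g.arity → Bool) × (Fin g.arity → Bool)) : ι → PauliBasis → Bool → ℂ :=
    Function.extend g.wires (fun l => shadowWeight (s.1 l) (s.2 l)) fun _ _ _ => 1 / 3
  have hestimate (β : ι → PauliBasis) (b : ι → Bool) : (∏ _i : ι, 1 / 3) * g.estimate β b =
      ∑ s, (g.op : Matrix _ _ ℂ) s.1 s.2 * ∏ i, f s i (β i) (b i) := by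
    rw [Gate.estimate, Finset.mul_sum]
    refine Finset.sum_congr rfl fun s _ => ?_
    rw [prod_extend g.wires _ _ fun i (h : PauliBasis → Bool → ℂ) => h (β i) (b i),
      ← Finset.prod_mul_prod_compl (Finset.univ.map g.wires), Finset.prod_map, mul_left_comm,
      mul_right_comm, ← Finset.prod_mul_distrib]
    congr! 3 with l
    ring
  have hfactor (s : (Fin g.arity → Bool) × (Fin g.arity → Bool)) (x y : ι → Bool) :
      ∏ i, qubitObservable (f s i) (x i) (y i) =
        (if s = (x ∘ g.wires, y ∘ g.wires) then 1 else 0) *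
          ∏ i ∈ (Finset.univ.map g.wires)ᶜ, (1 : Matrix Bool Bool ℂ) (x i) (y i) := by
    rw [prod_extend g.wires _ _ fun i h => qubitObservable h (x i) (y i)]
    simp only [qubitObservable_shadowWeight, qubitObservable_const_third, Matrix.single_apply,
      Fintype.prod_ite_zero, Finset.prod_const_one, forall_and, Prod.ext_iff, funext_iff,
      Function.comp_apply]
  ext x y
  simp only [hestimate, observable_sum_mul, Matrix.sum_apply, Matrix.smul_apply,
    observable_prod_apply, hfactor, smul_eq_mul, ite_mul, one_mul, zero_mul, mul_ite, mul_zero,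
    Finset.sum_ite_eq', Finset.mem_univ, if_true, Gate.toMatrix_apply]

end Gates

/-! ### The unary clock -/

section Clock

variable {m : ℕ} {ι : Type}

theorem unary_injOn (m : ℕ) : Set.InjOn (unary m) (Set.Iic m) := by
  intro j hj j' hj' h
  simp only [Set.mem_Iic] at hj hj'
  by_contra hne
  rcases Nat.lt_or_gt_of_ne hne with hlt | hlt
  · simpa [unary, hlt] using congrFun h ⟨j, by omega⟩
  · simpa [unary, hlt] using congrFun h ⟨j', by omega⟩

theorem unary_update (m : ℕ) (j : Fin m) (o : Bool) :
    Function.update (unary m j) j o = unary m (j + o.toNat) := by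
  ext i
  rcases eq_or_ne i j with rfl | hij
  · cases o <;> simp [unary]
  · rw [Function.update_of_ne hij]
    have : i.val ≠ j.val := Fin.val_ne_of_ne hij
    cases o
    · rfl
    · simp only [unary, Bool.toNat_true, decide_eq_decide]
      omega

/-- All clock qubits but the `j`-th have the value that they have at the times `j` and `j + 1`. -/
def NearTime (j : Fin m) (c : Fin m → Bool) : Prop := ∀ i, i ≠ j → c i = unary m j i

instance (j : Fin m) : DecidablePred (NearTime j) := fun _ => inferInstanceAs (Decidable (∀ _, _))

theorem nearTime_iff {j : Fin m} {c : Fin m → Bool} :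
    NearTime j c ↔ unary m (j + (c j).toNat) = c := by
  rw [← unary_update, Function.update_eq_iff]
  simp only [true_and, NearTime, eq_comm]

theorem sum_nearTime {M : Type*} [AddCommMonoid M] (j : Fin m) (F : (Fin m → Bool) → M) :
    ∑ c, (if NearTime j c then F c else 0) = ∑ o : Bool, F (unary m (j + o.toNat)) := by
  rw [← Finset.sum_filter]
  refine (Finset.sum_bij' (fun o _ => unary m (j + o.toNat)) (fun c _ => c j) ?_ ?_ ?_ ?_ ?_).symm
  · intro o _
    refine Finset.mem_filter.2 ⟨Finset.mem_univ _, fun i hi => ?_⟩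
    rw [← unary_update, Function.update_of_ne hi]
  · simp
  · intro o _
    rw [← unary_update, Function.update_self]
  · intro c hc
    exact nearTime_iff.1 (Finset.mem_filter.1 hc).2
  · simp

/-- The basis state with clock value `j` and content `d` of the other registers. -/
def timeState (m j : ℕ) (d : ι → Bool) : Fin m ⊕ ι → Bool := Sum.elim (unary m j) d

/-- The block of `ρ` between the clock values `j` and `j'`. -/
def clockBlock (ρ : Matrix (Fin m ⊕ ι → Bool) (Fin m ⊕ ι → Bool) ℂ) (j j' : ℕ) :
    Matrix (ι → Bool) (ι → Bool) ℂ :=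
  ρ.submatrix (timeState m j) (timeState m j')

variable [Fintype ι] [DecidableEq ι]

theorem sum_sum_elim {κ M : Type*} [Fintype κ] [DecidableEq κ] [AddCommMonoid M]
    (F : (κ ⊕ ι → Bool) → M) :
    ∑ z, F z = ∑ c : κ → Bool, ∑ d : ι → Bool, F (Sum.elim c d) := by
  rw [← (Equiv.sumArrowEquivProdArrow _ _ _).symm.sum_comp, Fintype.sum_prod_type]
  rfl

theorem sum_clock_eq {M : Type*} [AddCommMonoid M] (j : ℕ) (F : (Fin m ⊕ ι → Bool) → M) :
    ∑ z, (if z ∘ Sum.inl = unary m j then F z else 0) = ∑ d, F (timeState m j d) := by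
  simp only [sum_sum_elim, Sum.elim_comp_inl]
  rw [Finset.sum_eq_single (unary m j) (fun c _ hc => by simp only [hc, if_false,
    Finset.sum_const_zero]) (by simp)]
  simp only [if_true]
  rfl

/-- The probability of the clock value `j` in a measurement in the `Z` basis. -/
def clockWeight (ρ : Matrix (Fin m ⊕ ι → Bool) (Fin m ⊕ ι → Bool) ℂ) (j : ℕ) : ℝ :=
  (clockBlock ρ j j).trace.re

variable {ρ : Matrix (Fin m ⊕ ι → Bool) (Fin m ⊕ ι → Bool) ℂ}

theorem clockWeight_nonneg (hρ : ρ.PosSemidef) (j : ℕ) : 0 ≤ clockWeight ρ j :=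
  (Complex.nonneg_iff.1 (hρ.submatrix _).trace_nonneg).1

theorem clockWeight_eq_sum (ρ : Matrix (Fin m ⊕ ι → Bool) (Fin m ⊕ ι → Bool) ℂ) (j : ℕ) :
    clockWeight ρ j = ∑ z, if z ∘ Sum.inl = unary m j then (ρ z z).re else 0 := by
  rw [sum_clock_eq, clockWeight, Matrix.trace, Complex.re_sum]
  rfl

theorem sum_clock_le_one (c : Fin m → Bool) :
    ∑ j ∈ Finset.range (m + 1), (if c = unary m j then (1 : ℝ) else 0) ≤ 1 := by
  rw [Finset.sum_boole]
  norm_cast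
  refine Finset.card_le_one.2 fun i hi j hj => ?_
  simp only [Finset.mem_filter, Finset.mem_range, Nat.lt_succ_iff] at hi hj
  exact unary_injOn m hi.1 hj.1 (hi.2.symm.trans hj.2)

theorem sum_diag_re (hρ : IsDensity ρ) : ∑ z, (ρ z z).re = 1 := by
  simpa [Matrix.trace] using congrArg Complex.re hρ.2

theorem diag_re_nonneg (hρ : IsDensity ρ) (z : Fin m ⊕ ι → Bool) : 0 ≤ (ρ z z).re :=
  (Complex.nonneg_iff.1 hρ.1.diag_nonneg).1

theorem sum_clockWeight_le_one (hρ : IsDensity ρ) :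
    ∑ j ∈ Finset.range (m + 1), clockWeight ρ j ≤ 1 := by
  calc ∑ j ∈ Finset.range (m + 1), clockWeight ρ j
      = ∑ z, (ρ z z).re * ∑ j ∈ Finset.range (m + 1),
          (if z ∘ Sum.inl = unary m j then (1 : ℝ) else 0) := by
        simp only [clockWeight_eq_sum, Finset.mul_sum, mul_boole]
        exact Finset.sum_comm
    _ ≤ ∑ z, (ρ z z).re := Finset.sum_le_sum fun z _ =>
        mul_le_of_le_one_right (diag_re_nonneg hρ z) (sum_clock_le_one _)
    _ = 1 := sum_diag_re hρ

end Clock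

/-! ### Testing the gates -/

section Coins

variable {m : ℕ} {ι : Type}

/-- In the test of the `j`-th gate the clock qubits except the `j`-th are measured in the
`Z` basis, the other qubits in a uniformly random basis. -/
def basisWeight (j : Fin m) : Fin m ⊕ ι → PauliBasis → ℝ
  | .inl i, p => if i = j then 1 / 3 else if p = .Z then 1 else 0
  | .inr _, _ => 1 / 3

theorem basisWeight_nonneg (j : Fin m) (i : Fin m ⊕ ι) (p : PauliBasis) :
    0 ≤ basisWeight j i p := by
  rcases i with i | i <;> simp only [basisWeight]
  · split_ifs <;> norm_num
  · norm_num

theorem sum_basisWeight (j : Fin m) (i : Fin m ⊕ ι) : ∑ p, basisWeight j i p = 1 := by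
  rcases i with i | i <;> simp only [basisWeight, sum_pauliBasis, reduceCtorEq, if_true, if_false]
  · split_ifs <;> norm_num
  · norm_num

/-- The coins of one round: either all qubits are measured in the `Z` basis, or one of the gates is
tested with the given bases. -/
abbrev EnergyCoin (m : ℕ) (ι : Type) : Type := Option (Fin m × (Fin m ⊕ ι → PauliBasis))

/-- The bases determined by the coins. -/
def coinBasis : EnergyCoin m ι → Fin m ⊕ ι → PauliBasis
  | none => fun _ => .Z
  | some (_, β) => β

variable [Fintype ι]

instance [DecidableEq ι] : Fintype (EnergyCoin m ι) := inferInstance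

/-- With probability `1/2` all qubits are measured in the `Z` basis, otherwise a uniformly random
gate is tested. -/
def coinWeight : EnergyCoin m ι → ℝ
  | none => 1 / 2
  | some (j, β) => 1 / (2 * m) * ∏ i, basisWeight j i (β i)

theorem coinWeight_mem_stdSimplex [NeZero m] [DecidableEq ι] :
    (coinWeight : EnergyCoin m ι → ℝ) ∈ stdSimplex ℝ (EnergyCoin m ι) := by
  constructor
  · rintro (_ | ⟨j, β⟩)
    · norm_num [coinWeight]
    · exact mul_nonneg (by positivity) (Finset.prod_nonneg fun i _ => basisWeight_nonneg j i _)
  · have hprod (j : Fin m) : ∑ β : Fin m ⊕ ι → PauliBasis, ∏ i, basisWeight j i (β i) = 1 := by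
      rw [← Fintype.prod_sum]
      simp only [sum_basisWeight, Finset.prod_const_one]
    have hm : (m : ℝ) ≠ 0 := NeZero.ne _
    rw [Fintype.sum_option, Fintype.sum_prod_type]
    simp only [coinWeight, ← Finset.mul_sum, hprod, Finset.sum_const, Finset.card_univ,
      Fintype.card_fin, nsmul_eq_mul]
    field_simp
    norm_num

end Coins

section GateTest

variable {m : ℕ} {ι : Type}

theorem prod_ite_eq_ite_forall_ne {α M : Type*} [Fintype α] [DecidableEq α] [CommMonoidWithZero M]
    (j : α) (a : α → M) (P : α → Prop) [DecidablePred P]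
    [Decidable (∀ i, i ≠ j → P i)] :
    ∏ i, (if i = j then a i else if P i then 1 else 0) = if ∀ i, i ≠ j → P i then a j else 0 := by
  rw [Fintype.prod_eq_mul_prod_compl j, if_pos rfl, Finset.prod_congr rfl fun i hi =>
    if_neg (Finset.notMem_singleton.1 (Finset.mem_compl.1 hi)), Finset.prod_ite_zero]
  simp only [Finset.prod_const_one, mul_ite, mul_one, mul_zero, Finset.mem_compl,
    Finset.mem_singleton]

variable [Fintype ι]

theorem prod_basisWeight_mul_ite_nearTime (j : Fin m) (h : PauliBasis → Bool → ℂ) (c : ℂ)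
    (β : Fin m ⊕ ι → PauliBasis) (b : Fin m → Bool) :
    ((∏ i, basisWeight j i (β i) : ℝ) : ℂ) *
        (if NearTime j b then 3 * h (β (.inl j)) (b j) * c else 0) =
      (∏ i, if i = j then h (β (.inl i)) (b i) else
        if β (.inl i) = .Z ∧ b i = unary m j i then 1 else 0) * ((∏ _i : ι, 1 / 3) * c) := by
  simp only [Fintype.prod_sum_type, basisWeight]
  rw [prod_ite_eq_ite_forall_ne, prod_ite_eq_ite_forall_ne]
  by_cases hb : NearTime j b
  · by_cases hβ : ∀ i, i ≠ j → β (.inl i) = .Z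
    · rw [if_pos hβ, if_pos hb, if_pos fun i hi => ⟨hβ i hi, hb i hi⟩]
      push_cast
      ring
    · rw [if_neg hβ, if_neg fun H : ∀ i, i ≠ j → β (.inl i) = .Z ∧ _ => hβ fun i hi => (H i hi).1,
        zero_mul, zero_mul, Complex.ofReal_zero, zero_mul]
  · rw [if_neg hb, if_neg fun H : ∀ i, i ≠ j → _ ∧ _ => hb fun i hi => (H i hi).2,
      mul_zero, zero_mul]

variable [DecidableEq ι]

theorem observable_nearTime (j : Fin m) (h : PauliBasis → Bool → ℂ)
    (K : (ι → PauliBasis) → (ι → Bool) → ℂ) :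
    observable (fun β b => ((∏ i, basisWeight j i (β i) : ℝ) : ℂ) *
        if NearTime j (b ∘ Sum.inl) then
          3 * h (β (.inl j)) (b (.inl j)) * K (β ∘ Sum.inr) (b ∘ Sum.inr) else 0) =
      .of fun x y => if NearTime j (x ∘ Sum.inl) ∧ NearTime j (y ∘ Sum.inl) then
        qubitObservable h (x (.inl j)) (y (.inl j)) *
          observable (fun β b => (∏ _i : ι, 1 / 3) * K β b) (x ∘ Sum.inr) (y ∘ Sum.inr)
        else 0 := by
  let f (i : Fin m) (p : PauliBasis) (c : Bool) : ℂ :=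
    if i = j then h p c else if p = .Z ∧ c = unary m j i then 1 else 0
  have hf (β : Fin m ⊕ ι → PauliBasis) (b : Fin m ⊕ ι → Bool) :
      ((∏ i, basisWeight j i (β i) : ℝ) : ℂ) * (if NearTime j (b ∘ Sum.inl) then
          3 * h (β (.inl j)) (b (.inl j)) * K (β ∘ Sum.inr) (b ∘ Sum.inr) else 0) =
        (∏ i, f i ((β ∘ Sum.inl) i) ((b ∘ Sum.inl) i)) *
          ((∏ _i : ι, 1 / 3) * K (β ∘ Sum.inr) (b ∘ Sum.inr)) :=
    prod_basisWeight_mul_ite_nearTime j h _ β (b ∘ Sum.inl)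
  have hclock (i : Fin m) (x y : Bool) : qubitObservable (f i) x y =
      if i = j then qubitObservable h x y else
        if x = unary m j i ∧ y = unary m j i then 1 else 0 := by
    by_cases hi : i = j
    · simp only [f, hi, if_true]
    · simp only [f, hi, if_false, qubitObservable_Z, Matrix.single_apply]
      simp only [eq_comm]
  ext x y
  simp only [hf, Matrix.of_apply]
  rw [observable_mul_apply (fun β b => ∏ i, f i (β i) (b i)) fun β b => (∏ _i : ι, 1 / 3) * K β b,
    observable_prod_apply]
  simp only [hclock]
  rw [prod_ite_eq_ite_forall_ne, ite_mul, zero_mul]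
  exact if_congr ⟨fun H => ⟨fun i hi => (H i hi).1, fun i hi => (H i hi).2⟩,
    fun H i hi => ⟨H.1 i hi, H.2 i hi⟩⟩ rfl rfl

variable {ρ : Matrix (Fin m ⊕ ι → Bool) (Fin m ⊕ ι → Bool) ℂ}

theorem trace_mul_nearTime (j : Fin m) (Q : Matrix Bool Bool ℂ)
    (R : Matrix (ι → Bool) (ι → Bool) ℂ) :
    (ρ * Matrix.of fun x y => if NearTime j (x ∘ Sum.inl) ∧ NearTime j (y ∘ Sum.inl) then
        Q (x (.inl j)) (y (.inl j)) * R (x ∘ Sum.inr) (y ∘ Sum.inr) else 0).trace =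
      ∑ o : Bool, ∑ o' : Bool, Q o' o *
        (clockBlock ρ (j + o.toNat) (j + o'.toNat) * R).trace := by
  have hsum (F : (Fin m ⊕ ι → Bool) → ℂ) :
      ∑ x, (if NearTime j (x ∘ Sum.inl) then F x else 0) =
        ∑ o : Bool, ∑ d, F (timeState m (j + o.toNat) d) := by
    refine (sum_sum_elim _).trans (Finset.sum_comm.trans (Eq.trans ?_ Finset.sum_comm))
    exact Finset.sum_congr rfl fun d _ => sum_nearTime j fun c => F (Sum.elim c d)
  have hclock (o : Bool) (d : ι → Bool) : timeState m (j + o.toNat) d (.inl j) = o := by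
    rw [timeState, Sum.elim_inl, ← unary_update, Function.update_self]
  have hdata (l : ℕ) (d : ι → Bool) : timeState m l d ∘ Sum.inr = d := Sum.elim_comp_inr _ _
  simp only [Matrix.trace, Matrix.diag_apply, Matrix.mul_apply, Matrix.of_apply]
  calc ∑ x, ∑ y, ρ x y * (if NearTime j (y ∘ Sum.inl) ∧ NearTime j (x ∘ Sum.inl) then
        Q (y (.inl j)) (x (.inl j)) * R (y ∘ Sum.inr) (x ∘ Sum.inr) else 0)
      = ∑ x, if NearTime j (x ∘ Sum.inl) then ∑ y, (if NearTime j (y ∘ Sum.inl) then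
          ρ x y * (Q (y (.inl j)) (x (.inl j)) * R (y ∘ Sum.inr) (x ∘ Sum.inr)) else 0)
          else 0 := by
        refine Finset.sum_congr rfl fun x _ => ?_
        by_cases hx : NearTime j (x ∘ Sum.inl)
        · simp only [hx, and_true, if_true, mul_ite, mul_zero]
        · simp only [hx, and_false, if_false, mul_zero, Finset.sum_const_zero]
    _ = ∑ o : Bool, ∑ o' : Bool, Q o' o *
          ∑ d, ∑ d', clockBlock ρ (j + o.toNat) (j + o'.toNat) d d' * R d' d := by
        simp only [hsum, hclock, hdata, Finset.mul_sum, mul_left_comm]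
        exact Finset.sum_congr rfl fun o _ => Finset.sum_comm

theorem sum_basisWeight_mul_born (hρ : ρ.IsHermitian) (j : Fin m) (h : PauliBasis → Bool → ℂ)
    (K : (ι → PauliBasis) → (ι → Bool) → ℂ) :
    ∑ β, ∑ b, ((∏ i, basisWeight j i (β i)) * born ρ β b) *
        (if NearTime j (b ∘ Sum.inl) then
          (3 * h (β (.inl j)) (b (.inl j)) * K (β ∘ Sum.inr) (b ∘ Sum.inr)).re else 0) =
      (∑ o : Bool, ∑ o' : Bool, qubitObservable h o' o *
        (clockBlock ρ (j + o.toNat) (j + o'.toNat) *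
          observable fun β b => (∏ _i : ι, 1 / 3) * K β b).trace).re := by
  rw [← trace_mul_nearTime, ← observable_nearTime, ← sum_mul_born hρ]
  simp only [Complex.re_sum]
  refine Finset.sum_congr rfl fun β _ => Finset.sum_congr rfl fun b _ => ?_
  rw [mul_right_comm, Complex.re_mul_ofReal, Complex.re_ofReal_mul, apply_ite Complex.re,
    Complex.zero_re]

theorem sum_basisWeight_mul_born_nearTime (hρ : ρ.IsHermitian) (j : Fin m) :
    ∑ β, ∑ b, ((∏ i, basisWeight j i (β i)) * born ρ β b) *
        (if NearTime j (b ∘ Sum.inl) then 1 else 0) =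
      clockWeight ρ j + clockWeight ρ (j + 1) := by
  have h := sum_basisWeight_mul_born hρ j (fun _ _ => 1 / 3) fun _ _ => 1
  have hone : (observable fun (_ : ι → PauliBasis) _ => (∏ _i : ι, 1 / 3) * 1) = 1 := by
    ext x y
    simpa only [mul_one, qubitObservable_const_third, prod_one_apply] using
      observable_prod_apply (fun _ _ _ => 1 / 3) x y
  rw [qubitObservable_const_third, hone] at h
  have hre : (3 * (1 / 3) * 1 : ℂ).re = 1 := by norm_num
  simp only [hre] at h
  rw [h, add_comm]
  simp [Matrix.one_apply, clockWeight]

theorem sum_basisWeight_mul_born_estimate (hρ : ρ.IsHermitian) (j : Fin m) (g : Gate ι) :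
    ∑ β, ∑ b, ((∏ i, basisWeight j i (β i)) * born ρ β b) *
        (if NearTime j (b ∘ Sum.inl) then (3 * shadowWeight true false (β (.inl j)) (b (.inl j)) *
          g.estimate (β ∘ Sum.inr) (b ∘ Sum.inr)).re else 0) =
      (clockBlock ρ j (j + 1) * g.toMatrix).trace.re := by
  rw [sum_basisWeight_mul_born hρ, qubitObservable_shadowWeight, Gate.observable_estimate]
  simp [Matrix.single_apply]

end GateTest

/-! ### The energy of a message and its estimate -/

/-- A circuit of `m` gates on the qubits `ι`, together with the basis states that are allowed as
inputs and those that count as accepting outputs. The prover claims to send the history state of an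
accepting run of the circuit. -/
structure HistoryTest (m : ℕ) (ι : Type) where
  gate : Fin m → Gate ι
  input : Set (ι → Bool)
  accept : Set (ι → Bool)

namespace HistoryTest

variable {m : ℕ} {ι : Type} (θ : HistoryTest m ι)

/-- The penalty for the outcome of a measurement in the `Z` basis: illegal clock values, wrong
inputs and rejecting outputs. The weight `(m + 1)⁻¹` of the latter makes up for the output of an
honest message being rejected with a small probability only. -/
def penalty (z : Fin m ⊕ ι → Bool) : ℝ :=
  (1 - ∑ j ∈ Finset.range (m + 1), if z ∘ Sum.inl = unary m j then 1 else 0) +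
    (if z ∘ Sum.inl = unary m 0 then θ.inputᶜ.indicator 1 (z ∘ Sum.inr) else 0) +
    (if z ∘ Sum.inl = unary m m then (m + 1 : ℝ)⁻¹ * θ.acceptᶜ.indicator 1 (z ∘ Sum.inr) else 0)

theorem penalty_mem_Icc (z : Fin m ⊕ ι → Bool) : θ.penalty z ∈ Set.Icc 0 3 := by
  have hclock := sum_clock_le_one (z ∘ Sum.inl)
  have hclock' : 0 ≤ ∑ j ∈ Finset.range (m + 1),
      (if z ∘ Sum.inl = unary m j then (1 : ℝ) else 0) :=
    Finset.sum_nonneg fun _ _ => by split_ifs <;> norm_num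
  have hind (E : Set (ι → Bool)) (d : ι → Bool) :
      E.indicator (1 : (ι → Bool) → ℝ) d ∈ Set.Icc 0 1 :=
    ⟨Set.indicator_nonneg (fun _ _ => zero_le_one) d,
      Set.indicator_le_self' (fun _ _ => zero_le_one) d⟩
  have hinv : (m + 1 : ℝ)⁻¹ ≤ 1 := inv_le_one_of_one_le₀ (by simp)
  have hinv' : 0 ≤ (m + 1 : ℝ)⁻¹ := by positivity
  have hin := hind θ.inputᶜ (z ∘ Sum.inr)
  have hout := hind θ.acceptᶜ (z ∘ Sum.inr)
  unfold penalty
  rw [Set.mem_Icc] at *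
  constructor <;> split_ifs <;> nlinarith

/-- The estimate of the energy of the `j`-th gate from a test of that gate. -/
def gateStat (j : Fin m) (β : Fin m ⊕ ι → PauliBasis) (b : Fin m ⊕ ι → Bool) : ℝ :=
  if NearTime j (b ∘ Sum.inl) then
    1 / 2 - (3 * shadowWeight true false (β (.inl j)) (b (.inl j)) *
      (θ.gate j).estimate (β ∘ Sum.inr) (b ∘ Sum.inr)).re
  else 0

/-- The estimate of the energy from the record of one round. -/
def energyStat : EnergyCoin m ι × (Fin m ⊕ ι → Bool) → ℝ
  | (none, b) => 2 * θ.penalty b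
  | (some (j, β), b) => 2 * m * θ.gateStat j β b

variable {θ} {k : ℕ}

theorem abs_gateStat_le (hk : ∀ j, (θ.gate j).arity ≤ k) (j : Fin m)
    (β : Fin m ⊕ ι → PauliBasis) (b : Fin m ⊕ ι → Bool) :
    |θ.gateStat j β b| ≤ if NearTime j (b ∘ Sum.inl) then 4 * 12 ^ k else 0 := by
  unfold gateStat
  split_ifs
  · have hpow : (1 : ℝ) ≤ 12 ^ k := one_le_pow₀ (by norm_num)
    have hgate : ‖(θ.gate j).estimate (β ∘ Sum.inr) (b ∘ Sum.inr)‖ ≤ 12 ^ k :=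
      (Gate.norm_estimate_le _ _ _).trans (pow_le_pow_right₀ (by norm_num) (hk j))
    have hclock : ‖3 * shadowWeight true false (β (.inl j)) (b (.inl j))‖ ≤ 3 := by
      rw [norm_mul, Complex.norm_ofNat]
      linarith [norm_shadowWeight_le true false (β (.inl j)) (b (.inl j))]
    have hprod := (Complex.abs_re_le_norm _).trans
      ((norm_mul_le _ _).trans (mul_le_mul hclock hgate (norm_nonneg _) zero_le_three))
    rw [abs_le] at hprod ⊢
    constructor <;> linarith
  · rw [abs_zero]

theorem abs_energyStat_le (hk : ∀ j, (θ.gate j).arity ≤ k)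
    (ω : EnergyCoin m ι × (Fin m ⊕ ι → Bool)) :
    |θ.energyStat ω| ≤ 6 * (m + 1) * (4 * 12 ^ k) := by
  have hpow : (1 : ℝ) ≤ 12 ^ k := one_le_pow₀ (by norm_num)
  rcases ω with ⟨_ | ⟨j, β⟩, b⟩
  · obtain ⟨h0, h3⟩ := θ.penalty_mem_Icc b
    rw [energyStat, abs_of_nonneg (by linarith)]
    nlinarith [m.cast_nonneg (α := ℝ)]
  · have hgate : |θ.gateStat j β b| ≤ 4 * 12 ^ k :=
      (abs_gateStat_le hk j β b).trans (ite_le_sup _ _ _ |>.trans (by simp))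
    rw [energyStat, abs_mul, abs_of_nonneg (by positivity)]
    nlinarith [m.cast_nonneg (α := ℝ)]

end HistoryTest

section Energy

variable {m : ℕ} {ι : Type} [Fintype ι] [DecidableEq ι] (θ : HistoryTest m ι)
  (ρ : Matrix (Fin m ⊕ ι → Bool) (Fin m ⊕ ι → Bool) ℂ)

/-- The law of the record of one round. -/
def roundLaw (ω : EnergyCoin m ι × (Fin m ⊕ ι → Bool)) : ℝ :=
  coinWeight ω.1 * born ρ (coinBasis ω.1) ω.2

/-- The energy of a message with respect to the Feynman–Kitaev term of the `j`-th gate, which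
vanishes for history states. -/
def HistoryTest.gateEnergy (j : Fin m) : ℝ :=
  (clockWeight ρ j + clockWeight ρ (j + 1)) / 2 -
    (clockBlock ρ j (j + 1) * (θ.gate j).toMatrix).trace.re

/-- The energy of a message with respect to the Feynman–Kitaev Hamiltonian of the test. -/
def HistoryTest.energy : ℝ :=
  (1 - ∑ j ∈ Finset.range (m + 1), clockWeight ρ j) +
    eventProb (fun d => (clockBlock ρ 0 0 d d).re) θ.inputᶜ +
    (m + 1 : ℝ)⁻¹ * eventProb (fun d => (clockBlock ρ m m d d).re) θ.acceptᶜ +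
    ∑ j, θ.gateEnergy ρ j

variable {θ ρ} {k : ℕ}

theorem roundLaw_mem_stdSimplex [NeZero m] (hρ : IsDensity ρ) :
    roundLaw ρ ∈ stdSimplex ℝ (EnergyCoin m ι × (Fin m ⊕ ι → Bool)) := by
  have hborn (β : Fin m ⊕ ι → PauliBasis) : ∑ b, born ρ β b = 1 := by
    exact_mod_cast (sum_born hρ.1.isHermitian β).trans hρ.2
  refine ⟨fun ω => mul_nonneg (coinWeight_mem_stdSimplex.1 _) (born_nonneg hρ.1 _ _), ?_⟩
  rw [Fintype.sum_prod_type]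
  simp only [roundLaw, ← Finset.mul_sum, hborn, mul_one]
  exact coinWeight_mem_stdSimplex.2

theorem sum_roundLaw_mul (f : EnergyCoin m ι × (Fin m ⊕ ι → Bool) → ℝ) :
    ∑ ω, roundLaw ρ ω * f ω = 1 / 2 * ∑ b, (ρ b b).re * f (none, b) +
      1 / (2 * m) * ∑ j, ∑ β, ∑ b,
        (∏ i, basisWeight j i (β i)) * born ρ β b * f (some (j, β), b) := by
  rw [Fintype.sum_prod_type, Fintype.sum_option, Fintype.sum_prod_type]
  simp only [roundLaw, coinWeight, coinBasis, born_Z, Finset.mul_sum, mul_assoc]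

namespace HistoryTest

theorem sum_gateStat (hρ : ρ.IsHermitian) (j : Fin m) :
    ∑ β, ∑ b, (∏ i, basisWeight j i (β i)) * born ρ β b * θ.gateStat j β b =
      θ.gateEnergy ρ j := by
  rw [gateEnergy, ← sum_basisWeight_mul_born_nearTime hρ,
    ← sum_basisWeight_mul_born_estimate hρ, Finset.sum_div, ← Finset.sum_sub_distrib]
  refine Finset.sum_congr rfl fun β _ => ?_
  rw [Finset.sum_div, ← Finset.sum_sub_distrib]
  refine Finset.sum_congr rfl fun b _ => ?_
  rw [gateStat]
  split_ifs <;> ring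

theorem sum_penalty (hρ : IsDensity ρ) :
    ∑ b, (ρ b b).re * θ.penalty b = θ.energy ρ - ∑ j, θ.gateEnergy ρ j := by
  have hclock : ∑ b, (ρ b b).re * (1 - ∑ j ∈ Finset.range (m + 1),
      if b ∘ Sum.inl = unary m j then 1 else 0) =
      1 - ∑ j ∈ Finset.range (m + 1), clockWeight ρ j := by
    simp only [mul_sub, mul_one, Finset.sum_sub_distrib, sum_diag_re hρ, Finset.mul_sum, mul_boole,
      clockWeight_eq_sum]
    rw [Finset.sum_comm]
  have hevent (j : ℕ) (c : ℝ) (E : Set (ι → Bool)) :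
      ∑ b : Fin m ⊕ ι → Bool, (ρ b b).re *
        (if b ∘ Sum.inl = unary m j then c * E.indicator 1 (b ∘ Sum.inr) else 0) =
      c * eventProb (fun d => (clockBlock ρ j j d d).re) E := by
    simp only [mul_ite, mul_zero]
    rw [sum_clock_eq j fun b => (ρ b b).re * (c * E.indicator 1 (b ∘ Sum.inr)), eventProb,
      Finset.mul_sum]
    refine Finset.sum_congr rfl fun d _ => ?_
    rw [mul_left_comm]
    change c * ((clockBlock ρ j j d d).re * E.indicator 1 d) = _
    by_cases hd : d ∈ E
    · simp only [Set.indicator_of_mem hd, Pi.one_apply, mul_one]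
    · simp only [Set.indicator_of_notMem hd, mul_zero]
  have hin := hevent 0 1 θ.inputᶜ
  simp only [one_mul] at hin
  simp only [penalty, mul_add, Finset.sum_add_distrib, hclock, hin, hevent]
  rw [energy, add_sub_cancel_right]

theorem mean_energyStat [NeZero m] (hρ : IsDensity ρ) :
    ∑ ω, roundLaw ρ ω * θ.energyStat ω = θ.energy ρ := by
  have hm : (m : ℝ) ≠ 0 := NeZero.ne _
  rw [sum_roundLaw_mul]
  simp only [energyStat, mul_left_comm _ (2 : ℝ), mul_left_comm _ (2 * m : ℝ), ← Finset.mul_sum,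
    sum_gateStat hρ.1.isHermitian, sum_penalty hρ]
  field_simp
  ring

theorem secondMoment_gateStat_le (hρ : ρ.PosSemidef) (hk : ∀ j, (θ.gate j).arity ≤ k)
    (j : Fin m) :
    ∑ β, ∑ b, (∏ i, basisWeight j i (β i)) * born ρ β b * θ.gateStat j β b ^ 2 ≤
      (4 * 12 ^ k) ^ 2 * (clockWeight ρ j + clockWeight ρ (j + 1)) := by
  rw [← sum_basisWeight_mul_born_nearTime hρ.isHermitian j]
  simp only [Finset.mul_sum]
  refine Finset.sum_le_sum fun β _ => Finset.sum_le_sum fun b _ => ?_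
  have hsq : θ.gateStat j β b ^ 2 ≤
      (4 * 12 ^ k) ^ 2 * if NearTime j (b ∘ Sum.inl) then 1 else 0 := by
    rw [← sq_abs]
    refine (pow_le_pow_left₀ (abs_nonneg _) (abs_gateStat_le hk j β b) 2).trans_eq ?_
    split_ifs <;> ring
  exact (mul_le_mul_of_nonneg_left hsq (mul_nonneg (Finset.prod_nonneg fun i _ =>
    basisWeight_nonneg j i _) (born_nonneg hρ _ _))).trans_eq (mul_left_comm _ _ _)

theorem sum_clockWeight_add_succ_le (hρ : IsDensity ρ) :
    ∑ j : Fin m, (clockWeight ρ j + clockWeight ρ (j + 1)) ≤ 2 := by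
  have hlast := sum_clockWeight_le_one hρ
  have hfirst := hlast
  rw [Finset.sum_range_succ] at hlast
  rw [Finset.sum_range_succ'] at hfirst
  rw [Finset.sum_add_distrib, Fin.sum_univ_eq_sum_range (clockWeight ρ),
    Fin.sum_univ_eq_sum_range fun j => clockWeight ρ (j + 1)]
  linarith [clockWeight_nonneg hρ.1 0, clockWeight_nonneg hρ.1 m]

theorem secondMoment_energyStat_le (hρ : IsDensity ρ) (hk : ∀ j, (θ.gate j).arity ≤ k) :
    ∑ ω, roundLaw ρ ω * θ.energyStat ω ^ 2 ≤ 22 * (m + 1) * (4 * 12 ^ k) ^ 2 := by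
  have hpow : (1 : ℝ) ≤ 12 ^ k := one_le_pow₀ (by norm_num)
  have hpenalty : ∑ b, (ρ b b).re * θ.energyStat (none, b) ^ 2 ≤ 36 := by
    calc ∑ b, (ρ b b).re * θ.energyStat (none, b) ^ 2
        ≤ ∑ b, (ρ b b).re * 36 := by
          gcongr with b
          · exact diag_re_nonneg hρ b
          · obtain ⟨h0, h3⟩ := θ.penalty_mem_Icc b
            rw [energyStat]
            nlinarith
      _ = 36 := by rw [← Finset.sum_mul, sum_diag_re hρ, one_mul]
  have hgate : ∑ j, ∑ β, ∑ b,
      (∏ i, basisWeight j i (β i)) * born ρ β b * θ.energyStat (some (j, β), b) ^ 2 ≤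
        (2 * m) ^ 2 * ((4 * 12 ^ k) ^ 2 * 2) := by
    simp only [energyStat, mul_pow _ (gateStat _ _ _ _), mul_left_comm _ ((2 * m : ℝ) ^ 2),
      ← Finset.mul_sum]
    gcongr
    refine (Finset.sum_le_sum fun j _ => secondMoment_gateStat_le hρ.1 hk j).trans ?_
    rw [← Finset.mul_sum]
    gcongr
    exact sum_clockWeight_add_succ_le hρ
  calc ∑ ω, roundLaw ρ ω * θ.energyStat ω ^ 2
      ≤ 1 / 2 * 36 + 1 / (2 * m) * ((2 * m) ^ 2 * ((4 * 12 ^ k) ^ 2 * 2)) := by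
        rw [sum_roundLaw_mul]
        gcongr
    _ = 18 + 4 * m * (4 * 12 ^ k) ^ 2 := by
        by_cases hm : (m : ℝ) = 0
        · norm_num [hm]
        · field_simp
          ring
    _ ≤ 22 * (m + 1) * (4 * 12 ^ k) ^ 2 := by nlinarith [m.cast_nonneg (α := ℝ)]

end HistoryTest

end Energy

/-! ### Mixtures of low energy -/

open scoped MatrixOrder Matrix.Norms.L2Operator in
theorem exists_eq_mul_conjTranspose {X : Type} [Fintype X] {ρ : Matrix X X ℂ}
    (hρ : ρ.PosSemidef) : ∃ A : Matrix X X ℂ, ρ = A * Aᴴ := by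
  classical
  obtain ⟨A, rfl⟩ := CStarAlgebra.nonneg_iff_eq_star_mul_self.mp hρ.nonneg
  exact ⟨star A, by rw [← Matrix.star_eq_conjTranspose, star_star]⟩

attribute [local instance] Matrix.frobeniusNormedAddCommGroup Matrix.frobeniusNormedSpace

section Frobenius

variable {X I : Type}

/-- The rows of `A` with index in `E`: the projection of the columns onto these basis states. -/
def rowProj (E : Set X) (A : Matrix X I ℂ) : Matrix X I ℂ :=
  Matrix.of (E.indicator A)

theorem rowProj_add_rowProj_compl (E : Set X) (A : Matrix X I ℂ) :
    rowProj E A + rowProj Eᶜ A = A :=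
  Set.indicator_self_add_compl E A

theorem rowProj_add (E : Set X) (A B : Matrix X I ℂ) :
    rowProj E (A + B) = rowProj E A + rowProj E B :=
  Set.indicator_add' E A B

variable [Fintype I]

theorem mul_conjTranspose_apply_self_re (A : Matrix X I ℂ) (x : X) :
    ((A * Aᴴ) x x).re = ∑ i, ‖A x i‖ ^ 2 := by
  simp [Matrix.mul_apply, Complex.mul_conj, Complex.normSq_eq_norm_sq, -Complex.ofReal_pow]

variable [Fintype X]

theorem frobenius_norm_sq (A : Matrix X I ℂ) : ‖A‖ ^ 2 = ∑ x, ∑ i, ‖A x i‖ ^ 2 := by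
  rw [Matrix.frobenius_norm_def, ← Real.sqrt_eq_rpow, Real.sq_sqrt]
  · simp only [Real.rpow_ofNat]
  · positivity

theorem frobenius_norm_sq_eq_trace (A : Matrix X I ℂ) : ‖A‖ ^ 2 = (A * Aᴴ).trace.re := by
  simp only [frobenius_norm_sq, Matrix.trace, Complex.re_sum, Matrix.diag_apply,
    mul_conjTranspose_apply_self_re]

theorem frobenius_norm_unitary_mul [DecidableEq X] {U : Matrix X X ℂ}
    (hU : U ∈ Matrix.unitaryGroup X ℂ) (A : Matrix X I ℂ) : ‖U * A‖ = ‖A‖ := by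
  rw [← sq_eq_sq₀ (norm_nonneg _) (norm_nonneg _), frobenius_norm_sq_eq_trace,
    frobenius_norm_sq_eq_trace, Matrix.conjTranspose_mul, ← Matrix.mul_assoc, Matrix.trace_mul_comm,
    Matrix.mul_assoc, ← Matrix.mul_assoc, ← Matrix.star_eq_conjTranspose U,
    Matrix.mem_unitaryGroup_iff'.1 hU, Matrix.one_mul]

theorem frobenius_norm_sub_sq (A B : Matrix X I ℂ) :
    ‖A - B‖ ^ 2 = ‖A‖ ^ 2 + ‖B‖ ^ 2 - 2 * (B * Aᴴ).trace.re := by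
  have hsymm : (A * Bᴴ).trace.re = (B * Aᴴ).trace.re := by
    rw [← Complex.conj_re, ← Complex.star_def, ← Matrix.trace_conjTranspose,
      Matrix.conjTranspose_mul, Matrix.conjTranspose_conjTranspose]
  simp only [frobenius_norm_sq_eq_trace, Matrix.conjTranspose_sub, Matrix.sub_mul, Matrix.mul_sub,
    Matrix.trace_sub, Complex.sub_re, hsymm]
  ring

theorem norm_rowProj_sq (E : Set X) (A : Matrix X I ℂ) :
    ‖rowProj E A‖ ^ 2 = eventProb (fun x => ∑ i, ‖A x i‖ ^ 2) E := by
  rw [frobenius_norm_sq, eventProb]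
  refine Finset.sum_congr rfl fun x _ => ?_
  by_cases hx : x ∈ E
  · rw [show rowProj E A x = A x from Set.indicator_of_mem hx A, Set.indicator_of_mem hx]
  · rw [show rowProj E A x = 0 from Set.indicator_of_notMem hx A, Set.indicator_of_notMem hx]
    simp

theorem norm_rowProj_le (E : Set X) (A : Matrix X I ℂ) : ‖rowProj E A‖ ≤ ‖A‖ := by
  rw [← sq_le_sq₀ (norm_nonneg _) (norm_nonneg _), norm_rowProj_sq, frobenius_norm_sq]
  exact Finset.sum_le_sum fun x _ => Set.indicator_le_self' (fun _ _ => by positivity) x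

end Frobenius

section Mixture

variable {m : ℕ} {ι I : Type} [Fintype I]

/-- The part of an ensemble of vectors, the columns of `Φ`, that belongs to the clock value `j`. -/
def slice (Φ : Matrix (Fin m ⊕ ι → Bool) I ℂ) (j : ℕ) : Matrix (ι → Bool) I ℂ :=
  Φ.submatrix (timeState m j) id

theorem clockBlock_mul_conjTranspose (Φ : Matrix (Fin m ⊕ ι → Bool) I ℂ) (j j' : ℕ) :
    clockBlock (Φ * Φᴴ) j j' = slice Φ j * (slice Φ j')ᴴ :=
  rfl

variable [Fintype ι]

/-- The operator of the gate that is applied at time `j`. -/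
def HistoryTest.step (θ : HistoryTest m ι) (j : ℕ) : Matrix (ι → Bool) (ι → Bool) ℂ :=
  if h : j < m then (θ.gate ⟨j, h⟩).toMatrix else 1

theorem HistoryTest.step_val (θ : HistoryTest m ι) (j : Fin m) :
    θ.step j = (θ.gate j).toMatrix :=
  dif_pos j.2

variable [DecidableEq ι]

theorem clockWeight_mul_conjTranspose (Φ : Matrix (Fin m ⊕ ι → Bool) I ℂ) (j : ℕ) :
    clockWeight (Φ * Φᴴ) j = ‖slice Φ j‖ ^ 2 := by
  rw [clockWeight, clockBlock_mul_conjTranspose, frobenius_norm_sq_eq_trace]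

namespace HistoryTest

variable (θ : HistoryTest m ι)

/-- The product of the first `j` gates. -/
def evolution : ℕ → Matrix (ι → Bool) (ι → Bool) ℂ
  | 0 => 1
  | j + 1 => θ.step j * evolution j

theorem step_mem_unitaryGroup (j : ℕ) : θ.step j ∈ Matrix.unitaryGroup (ι → Bool) ℂ := by
  unfold step
  split_ifs with h
  · exact Gate.toMatrix_mem_unitaryGroup _
  · exact one_mem _

theorem evolution_mem_unitaryGroup (j : ℕ) :
    θ.evolution j ∈ Matrix.unitaryGroup (ι → Bool) ℂ := by
  induction j with
  | zero => exact one_mem _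
  | succ j ih => exact mul_mem (θ.step_mem_unitaryGroup j) ih

theorem gateEnergy_mul_conjTranspose (Φ : Matrix (Fin m ⊕ ι → Bool) I ℂ) (j : Fin m) :
    θ.gateEnergy (Φ * Φᴴ) j = ‖slice Φ (j + 1) - θ.step j * slice Φ j‖ ^ 2 / 2 := by
  rw [gateEnergy, clockWeight_mul_conjTranspose, clockWeight_mul_conjTranspose,
    frobenius_norm_sub_sq, frobenius_norm_unitary_mul (θ.step_mem_unitaryGroup j),
    clockBlock_mul_conjTranspose, Matrix.trace_mul_comm, step_val, Matrix.mul_assoc]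
  ring

theorem energy_mul_conjTranspose (Φ : Matrix (Fin m ⊕ ι → Bool) I ℂ) :
    θ.energy (Φ * Φᴴ) = (1 - ∑ j ∈ Finset.range (m + 1), ‖slice Φ j‖ ^ 2) +
      ‖rowProj θ.inputᶜ (slice Φ 0)‖ ^ 2 +
      (m + 1 : ℝ)⁻¹ * ‖rowProj θ.acceptᶜ (slice Φ m)‖ ^ 2 +
      (∑ j ∈ Finset.range m, ‖slice Φ (j + 1) - θ.step j * slice Φ j‖ ^ 2) / 2 := by
  simp only [energy, clockWeight_mul_conjTranspose, gateEnergy_mul_conjTranspose, norm_rowProj_sq,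
    clockBlock_mul_conjTranspose, mul_conjTranspose_apply_self_re, Finset.sum_div]
  rw [Fin.sum_univ_eq_sum_range fun j => ‖slice Φ (j + 1) - θ.step j * slice Φ j‖ ^ 2 / 2]

theorem norm_sub_evolution_mul_le (v : ℕ → Matrix (ι → Bool) I ℂ) (j : ℕ) :
    ‖v j - θ.evolution j * v 0‖ ≤ ∑ i ∈ Finset.range j, ‖v (i + 1) - θ.step i * v i‖ := by
  induction j with
  | zero => simp [evolution]
  | succ j ih =>
    have hsplit : v (j + 1) - θ.evolution (j + 1) * v 0 =
        θ.step j * (v j - θ.evolution j * v 0) + (v (j + 1) - θ.step j * v j) := by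
      rw [evolution, Matrix.mul_sub, Matrix.mul_assoc]
      abel
    rw [Finset.sum_range_succ, hsplit]
    refine (norm_add_le _ _).trans ?_
    rw [frobenius_norm_unitary_mul (θ.step_mem_unitaryGroup j)]
    gcongr

theorem norm_sub_evolution_mul_sq_le (v : ℕ → Matrix (ι → Bool) I ℂ) {j : ℕ} (hj : j ≤ m) :
    ‖v j - θ.evolution j * v 0‖ ^ 2 ≤
      (m + 1) * ∑ i ∈ Finset.range m, ‖v (i + 1) - θ.step i * v i‖ ^ 2 := by
  calc ‖v j - θ.evolution j * v 0‖ ^ 2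
      ≤ (∑ i ∈ Finset.range j, ‖v (i + 1) - θ.step i * v i‖) ^ 2 := by
        gcongr
        exact θ.norm_sub_evolution_mul_le v j
    _ ≤ (Finset.range j).card * ∑ i ∈ Finset.range j, ‖v (i + 1) - θ.step i * v i‖ ^ 2 :=
        sq_sum_le_card_mul_sum_sq
    _ ≤ (m + 1) * ∑ i ∈ Finset.range m, ‖v (i + 1) - θ.step i * v i‖ ^ 2 := by
        rw [Finset.card_range]
        have hjm : (j : ℝ) ≤ m := by exact_mod_cast hj
        gcongr
        linarith

/-! In a history state every clock value has the amplitude `r = (m + 1)^(-1/2)`. -/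

variable {θ} {Φ : Matrix (Fin m ⊕ ι → Bool) I ℂ} {η r : ℝ}

theorem norms_le_of_energy_le (hΦ : IsDensity (Φ * Φᴴ)) (hη : 0 < η) (hr : 0 < r)
    (hrm : r ^ 2 * (m + 1) = 1) (hE : θ.energy (Φ * Φᴴ) ≤ 3 * (η * r ^ 2) ^ 2) :
    ‖rowProj θ.inputᶜ (slice Φ 0)‖ ≤ 2 * (η * r) ∧
      ‖rowProj θ.acceptᶜ (slice Φ m)‖ ≤ 2 * (η * r) ∧
      (∀ j ≤ m, ‖slice Φ j - θ.evolution j * slice Φ 0‖ ≤ 5 / 2 * (η * r)) ∧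
      1 - 3 * (η * r) ^ 2 ≤ ∑ j ∈ Finset.range (m + 1), ‖slice Φ j‖ ^ 2 := by
  have hclock := sum_clockWeight_le_one hΦ
  simp only [clockWeight_mul_conjTranspose] at hclock
  rw [energy_mul_conjTranspose, ← eq_inv_of_mul_eq_one_left hrm] at hE
  have hr1 : r ^ 2 ≤ 1 := by nlinarith [m.cast_nonneg (α := ℝ), sq_nonneg r]
  have hin := sq_nonneg ‖rowProj θ.inputᶜ (slice Φ 0)‖
  have hout := sq_nonneg ‖rowProj θ.acceptᶜ (slice Φ m)‖
  have hsteps : 0 ≤ ∑ j ∈ Finset.range m, ‖slice Φ (j + 1) - θ.step j * slice Φ j‖ ^ 2 :=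
    Finset.sum_nonneg fun _ _ => sq_nonneg _
  have hηr : 0 < η * r := mul_pos hη hr
  have hsq : (η * r ^ 2) ^ 2 = (η * r) ^ 2 * r ^ 2 := by ring
  have hsq1 : (η * r) ^ 2 * r ^ 2 ≤ (η * r) ^ 2 := mul_le_of_le_one_right (sq_nonneg _) hr1
  have hout' := mul_nonneg (sq_nonneg r) hout
  rw [hsq] at hE
  refine ⟨?_, ?_, fun j hj => ?_, by linarith⟩ <;> refine le_of_sq_le_sq ?_ (by positivity)
  · nlinarith
  · have h : r ^ 2 * ‖rowProj θ.acceptᶜ (slice Φ m)‖ ^ 2 ≤ r ^ 2 * (3 * (η * r) ^ 2) := by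
      linarith
    nlinarith [le_of_mul_le_mul_left h (by positivity)]
  · have h := mul_le_mul_of_nonneg_left (θ.norm_sub_evolution_mul_sq_le (slice Φ) hj) (sq_nonneg r)
    rw [← mul_assoc, hrm, one_mul] at h
    have h' : r ^ 2 * ‖slice Φ j - θ.evolution j * slice Φ 0‖ ^ 2 ≤ r ^ 2 * (6 * (η * r) ^ 2) := by
      linarith
    nlinarith [le_of_mul_le_mul_left h' (by positivity)]

theorem le_norm_slice_zero (hη : 0 < η) (hη' : η ≤ 1 / 100) (hr : 0 < r)
    (hrm : r ^ 2 * (m + 1) = 1)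
    (hdrift : ∀ j ≤ m, ‖slice Φ j - θ.evolution j * slice Φ 0‖ ≤ 5 / 2 * (η * r))
    (hmass : 1 - 3 * (η * r) ^ 2 ≤ ∑ j ∈ Finset.range (m + 1), ‖slice Φ j‖ ^ 2) :
    4 / 5 * r ≤ ‖slice Φ 0‖ := by
  have hslice : ∀ j ∈ Finset.range (m + 1),
      ‖slice Φ j‖ ^ 2 ≤ (‖slice Φ 0‖ + 5 / 2 * (η * r)) ^ 2 := by
    intro j hj
    gcongr
    have h := norm_le_norm_add_norm_sub' (slice Φ j) (θ.evolution j * slice Φ 0)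
    rw [frobenius_norm_unitary_mul (θ.evolution_mem_unitaryGroup j)] at h
    exact h.trans (add_le_add_right (hdrift j (Finset.mem_range_succ_iff.1 hj)) _)
  have hsum := hmass.trans (Finset.sum_le_card_nsmul _ _ _ hslice)
  rw [Finset.card_range, nsmul_eq_mul, Nat.cast_succ] at hsum
  have hr1 : r ^ 2 ≤ 1 := by nlinarith [m.cast_nonneg (α := ℝ), sq_nonneg r]
  have hηr : η * r ≤ 1 / 100 * r := by gcongr
  have hηr0 : 0 < η * r := mul_pos hη hr
  have hsmall : (η * r) ^ 2 ≤ 1 / 10000 := by nlinarith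
  have hscaled := mul_le_mul_of_nonneg_left hsum (sq_nonneg r)
  rw [← mul_assoc, hrm, one_mul] at hscaled
  have : 9 / 10 * r ≤ ‖slice Φ 0‖ + 5 / 2 * (η * r) :=
    le_of_sq_le_sq (by nlinarith) (by positivity)
  linarith

theorem norm_rowProj_accept_compl_le_of_energy_le (hΦ : IsDensity (Φ * Φᴴ)) (hη : 0 < η)
    (hη' : η ≤ 1 / 100) (hE : θ.energy (Φ * Φᴴ) ≤ 3 * (η / (m + 1)) ^ 2) :
    0 < ‖rowProj θ.input (slice Φ 0)‖ ∧
      ‖rowProj θ.acceptᶜ (θ.evolution m * rowProj θ.input (slice Φ 0))‖ ≤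
        13 * η * ‖rowProj θ.input (slice Φ 0)‖ := by
  obtain ⟨r, hr, hrm⟩ : ∃ r : ℝ, 0 < r ∧ r ^ 2 * (m + 1) = 1 :=
    ⟨(√(m + 1))⁻¹, by positivity, by
      rw [inv_pow, Real.sq_sqrt (by positivity), inv_mul_cancel₀ (by positivity)]⟩
  rw [div_eq_mul_inv, ← eq_inv_of_mul_eq_one_left hrm] at hE
  obtain ⟨hin, hout, hdrift, hmass⟩ := norms_le_of_energy_le hΦ hη hr hrm hE
  have hstart := le_norm_slice_zero hη hη' hr hrm hdrift hmass
  set u := rowProj θ.input (slice Φ 0)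
  have hsplit : u + rowProj θ.inputᶜ (slice Φ 0) = slice Φ 0 := rowProj_add_rowProj_compl _ _
  have hηr : η * r ≤ 1 / 100 * r := by gcongr
  have hur : r / 2 ≤ ‖u‖ := by
    have h := norm_add_le u (rowProj θ.inputᶜ (slice Φ 0))
    rw [hsplit] at h
    linarith
  refine ⟨by linarith, ?_⟩
  have hdecomp : θ.evolution m * u = slice Φ m + -(slice Φ m - θ.evolution m * slice Φ 0 +
      θ.evolution m * rowProj θ.inputᶜ (slice Φ 0)) := by
    have hmul := congrArg (θ.evolution m * ·) hsplit
    simp only [Matrix.mul_add] at hmul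
    rw [← hmul]
    abel
  have herr := (norm_rowProj_le θ.acceptᶜ (-(slice Φ m - θ.evolution m * slice Φ 0 +
    θ.evolution m * rowProj θ.inputᶜ (slice Φ 0)))).trans_eq (norm_neg _) |>.trans (norm_add_le _ _)
  rw [frobenius_norm_unitary_mul (θ.evolution_mem_unitaryGroup m)] at herr
  rw [hdecomp, rowProj_add]
  refine (norm_add_le _ _).trans ?_
  have hfinal : η * (r / 2) ≤ η * ‖u‖ := by gcongr
  linarith [hdrift m le_rfl]

end HistoryTest

end Mixture

/-! ### The comparison circuit as a circuit of gates -/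

section PermutationGates

theorem permMatrix_mem_unitaryGroup {X : Type*} [Fintype X] [DecidableEq X] (σ : Equiv.Perm X) :
    σ.permMatrix ℂ ∈ Matrix.unitaryGroup X ℂ := by
  rw [Matrix.mem_unitaryGroup_iff, Matrix.star_eq_conjTranspose, Matrix.conjTranspose_permMatrix,
    ← Matrix.permMatrix_mul, inv_mul_cancel, Matrix.permMatrix_one]

theorem permMatrix_apply {X : Type*} [DecidableEq X] (σ : Equiv.Perm X) (x y : X) :
    σ.permMatrix ℂ x y = if σ x = y then 1 else 0 := by
  simp only [PEquiv.toMatrix_apply, Equiv.toPEquiv_apply, Option.mem_some_iff, eq_comm]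

theorem permMatrix_toPerm_apply {X : Type*} [DecidableEq X] {f : X → X}
    (hf : Function.Involutive f) (x y : X) :
    (hf.toPerm f).permMatrix ℂ x y = if x = f y then 1 else 0 := by
  rw [permMatrix_apply]
  exact if_congr hf.eq_iff rfl rfl

/-- The gate that permutes the basis states of its wires. -/
def Gate.ofPerm {ι : Type} {a : ℕ} (w : Fin a ↪ ι) (σ : Equiv.Perm (Fin a → Bool)) : Gate ι where
  arity := a
  wires := w
  op := ⟨σ.permMatrix ℂ, permMatrix_mem_unitaryGroup σ⟩

theorem Gate.toMatrix_ofPerm {ι : Type} [DecidableEq (ι → Bool)] {a : ℕ} {w : Fin a ↪ ι}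
    {σ : Equiv.Perm (Fin a → Bool)} {τ : Equiv.Perm (ι → Bool)}
    (hw : ∀ x, τ x ∘ w = σ (x ∘ w)) (hτ : ∀ x, ∀ i ∉ Set.range w, τ x i = x i) :
    (Gate.ofPerm w σ).toMatrix = τ.permMatrix ℂ := by
  ext x y
  have hiff : (∀ i ∉ Set.range w, x i = y i) ∧ σ (x ∘ w) = y ∘ w ↔ τ x = y := by
    constructor
    · rintro ⟨hout, hin⟩
      ext i
      by_cases hi : i ∈ Set.range w
      · obtain ⟨a, rfl⟩ := hi
        exact congrFun ((hw x).trans hin) a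
      · rw [hτ x i hi, hout i hi]
    · rintro rfl
      exact ⟨fun i hi => (hτ x i hi).symm, (hw x).symm⟩
  classical
  rw [permMatrix_apply, ← if_congr hiff rfl rfl, ite_and]
  exact ite_congr rfl (fun _ => permMatrix_apply σ _ _) fun _ => rfl

end PermutationGates

section ComparisonCircuit

theorem inv_sqrt_two_mul_self : ((√2 : ℝ) : ℂ)⁻¹ * ((√2 : ℝ) : ℂ)⁻¹ = 1 / 2 := by
  rw [← mul_inv, ← Complex.ofReal_mul, Real.mul_self_sqrt zero_le_two]
  norm_num

/-- The Hadamard operator on a single qubit. -/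
def hadamardOp : Matrix (Fin 1 → Bool) (Fin 1 → Bool) ℂ :=
  fun x y => (1 / (√2 : ℝ) : ℂ) * (if x 0 && y 0 then -1 else 1)

theorem hadamardOp_mem_unitaryGroup : hadamardOp ∈ Matrix.unitaryGroup (Fin 1 → Bool) ℂ := by
  rw [Matrix.mem_unitaryGroup_iff]
  ext x y
  obtain ⟨a, rfl⟩ := (Equiv.funUnique (Fin 1) Bool).symm.surjective x
  obtain ⟨b, rfl⟩ := (Equiv.funUnique (Fin 1) Bool).symm.surjective y
  rw [Matrix.mul_apply, ← (Equiv.funUnique (Fin 1) Bool).symm.sum_comp, Fintype.sum_bool]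
  have hsqrt := inv_sqrt_two_mul_self
  have hone : (1 : Matrix (Fin 1 → Bool) (Fin 1 → Bool) ℂ) ((Equiv.funUnique (Fin 1) Bool).symm a)
      ((Equiv.funUnique (Fin 1) Bool).symm b) = if a = b then 1 else 0 :=
    if_congr (Equiv.apply_eq_iff_eq _) rfl rfl
  simp only [hone, Matrix.star_apply, hadamardOp, Equiv.funUnique_symm_apply, uniqueElim_const]
  cases a <;> cases b <;> simp <;> linear_combination 2 * hsqrt

variable {n : ℕ}

theorem flipOut_involutive (n : ℕ) : Function.Involutive fun y : CompQubit n → Bool =>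
    Function.update y CompQubit.out (!y CompQubit.out) :=
  fun y => by simp

/-- Negation of the `out` qubit. -/
def flipOut (n : ℕ) : Equiv.Perm (CompQubit n → Bool) :=
  (flipOut_involutive n).toPerm

theorem flipOut_apply (y : CompQubit n → Bool) :
    flipOut n y = Function.update y CompQubit.out (!y CompQubit.out) :=
  rfl

theorem notOut_eq_permMatrix (n : ℕ) : notOut n = (flipOut n).permMatrix ℂ :=
  Matrix.ext fun x y => (permMatrix_toPerm_apply (flipOut_involutive n) x y).symm

theorem condSwap_involutive (i : Fin n) : Function.Involutive fun y : CompQubit n → Bool =>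
    if y CompQubit.out then y ∘ Equiv.swap (CompQubit.adv i) (CompQubit.aux i) else y := by
  intro y
  by_cases h : y CompQubit.out = true
  · ext j
    simp [h, Equiv.swap_apply_of_ne_of_ne]
  · simp only [if_neg h]

/-- The exchange of `adv i` and `aux i` controlled by `out`. -/
def condSwap (i : Fin n) : Equiv.Perm (CompQubit n → Bool) :=
  (condSwap_involutive i).toPerm

theorem condSwap_apply (i : Fin n) (y : CompQubit n → Bool) :
    condSwap i y =
      if y CompQubit.out then y ∘ Equiv.swap (CompQubit.adv i) (CompQubit.aux i) else y :=
  rfl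

theorem cswap_eq_permMatrix (i : Fin n) : cswap i = (condSwap i).permMatrix ℂ :=
  Matrix.ext fun x y => (permMatrix_toPerm_apply (condSwap_involutive i) x y).symm

/-- The `out` wire. -/
def outWire (n : ℕ) : Fin 1 ↪ CompQubit n :=
  ⟨fun _ => CompQubit.out, Function.injective_of_subsingleton _⟩

/-- The wires `out`, `adv i`, `aux i`. -/
def swapWires (i : Fin n) : Fin 3 ↪ CompQubit n :=
  ⟨![CompQubit.out, CompQubit.adv i, CompQubit.aux i], by
    intro a b
    fin_cases a <;> fin_cases b <;> simp⟩

theorem swapWires_apply (i : Fin n) (a : Fin 3) :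
    swapWires i a = ![CompQubit.out, CompQubit.adv i, CompQubit.aux i] a :=
  rfl

/-- The Hadamard gate on `out`. -/
def hadamardGate (n : ℕ) : Gate (CompQubit n) where
  arity := 1
  wires := outWire n
  op := ⟨hadamardOp, hadamardOp_mem_unitaryGroup⟩

/-- The NOT gate on `out`. -/
def notGate (n : ℕ) : Gate (CompQubit n) :=
  Gate.ofPerm (outWire n) (Function.Involutive.toPerm (fun y a => !y a) fun y => by simp)

/-- The swap of `adv i` and `aux i` controlled by `out`. -/
def cswapGate (i : Fin n) : Gate (CompQubit n) :=
  Gate.ofPerm (swapWires i)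
    (Function.Involutive.toPerm (fun y => if y 0 then y ∘ Equiv.swap 1 2 else y) fun y => by
      by_cases h : y 0 = true
      · ext a
        simp [h, Equiv.swap_apply_of_ne_of_ne]
      · simp only [if_neg h])

theorem toMatrix_hadamardGate (n : ℕ) : (hadamardGate n).toMatrix = hadamardOut n := by
  ext x y
  have hrange : ∀ i, i ∉ Set.range (hadamardGate n).wires ↔ i ≠ CompQubit.out := fun i =>
    not_congr ⟨fun ⟨_, h⟩ => h.symm, fun h => ⟨(0 : Fin 1), h.symm⟩⟩
  simp only [Gate.toMatrix, hadamardOut, hrange]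
  rfl

theorem toMatrix_notGate (n : ℕ) : (notGate n).toMatrix = notOut n := by
  rw [notOut_eq_permMatrix]
  exact Gate.toMatrix_ofPerm (fun x => funext fun _ => Function.update_self CompQubit.out _ x)
    fun x i hi => Function.update_of_ne (fun h => hi ⟨0, h.symm⟩) _ _

theorem toMatrix_cswapGate (i : Fin n) : (cswapGate i).toMatrix = cswap i := by
  rw [cswap_eq_permMatrix]
  refine Gate.toMatrix_ofPerm (fun x => ?_) fun x j hj => ?_
  · rw [condSwap_apply]
    change _ = if x CompQubit.out then _ else _
    split_ifs
    · ext a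
      simp only [Function.comp_apply, swapWires_apply]
      fin_cases a <;> simp [Equiv.swap_apply_of_ne_of_ne]
    · rfl
  · rw [condSwap_apply]
    split_ifs
    · exact congrArg x (Equiv.swap_apply_of_ne_of_ne (fun h => hj ⟨1, h.symm⟩)
        fun h => hj ⟨2, h.symm⟩)
    · rfl

/-- The gates of the comparison circuit as gates, not as operators on all the qubits. -/
def comparisonCircuit (C : List (Gate (Fin n))) : List (Gate (CompQubit n)) :=
  C.map (Gate.map (auxEmb n)) ++ [hadamardGate n] ++ List.ofFn cswapGate ++
    [hadamardGate n, notGate n]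

theorem map_toMatrix_comparisonCircuit (C : List (Gate (Fin n))) :
    (comparisonCircuit C).map Gate.toMatrix = comparisonGates C := by
  simp only [comparisonCircuit, comparisonGates, List.map_append, List.map_map, List.map_ofFn,
    List.map_cons, List.map_nil, toMatrix_hadamardGate, toMatrix_notGate, Function.comp_def,
    toMatrix_cswapGate]

theorem length_comparisonCircuit (C : List (Gate (Fin n))) :
    (comparisonCircuit C).length = n + C.length + 3 := by
  simp only [comparisonCircuit, List.length_append, List.length_map, List.length_ofFn,
    List.length_cons, List.length_nil]
  ring

theorem arity_le_of_mem_comparisonCircuit {C : List (Gate (Fin n))} {k : ℕ}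
    (hC : ∀ g ∈ C, g.arity ≤ k) : ∀ g ∈ comparisonCircuit C, g.arity ≤ max k 3 := by
  simp only [comparisonCircuit, List.mem_append, List.mem_map, List.mem_ofFn, List.mem_cons,
    List.not_mem_nil, or_false]
  rintro _ (((⟨g, hg, rfl⟩ | rfl) | ⟨i, rfl⟩) | rfl | rfl)
  · exact (hC g hg).trans (le_max_left _ _)
  · exact le_max_of_le_right (by norm_num [hadamardGate])
  · exact le_max_right _ _
  · exact le_max_of_le_right (by norm_num [hadamardGate])
  · exact le_max_of_le_right (by norm_num [notGate, Gate.ofPerm])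

/-- The comparison circuit as a test: its inputs are zero in `out` and `aux`, and it accepts if
`out` is one at the end. -/
def comparisonTest (C : List (Gate (Fin n))) : HistoryTest (n + C.length + 3) (CompQubit n) where
  gate j := (comparisonCircuit C).get (j.cast (length_comparisonCircuit C).symm)
  input := Set.range compInput
  accept := {d | d CompQubit.out}

theorem arity_gate_comparisonTest_le {C : List (Gate (Fin n))} {k : ℕ}
    (hC : ∀ g ∈ C, g.arity ≤ k) (j : Fin (n + C.length + 3)) :
    ((comparisonTest C).gate j).arity ≤ max k 3 :=
  arity_le_of_mem_comparisonCircuit hC _ (List.get_mem _ _)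

theorem evolution_comparisonTest_mulVec (C : List (Gate (Fin n)))
    (v : (CompQubit n → Bool) → ℂ) {j : ℕ} (hj : j ≤ n + C.length + 3) :
    (comparisonTest C).evolution j *ᵥ v = applyAll ((comparisonGates C).take j) v := by
  induction j with
  | zero => exact Matrix.one_mulVec v
  | succ j ih =>
    have hlen : j < (comparisonGates C).length := by
      rw [← map_toMatrix_comparisonCircuit, List.length_map, length_comparisonCircuit]
      exact hj
    have hstep : (comparisonTest C).step j = (comparisonGates C)[j] := by
      rw [HistoryTest.step, dif_pos (Nat.lt_of_succ_le hj)]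
      simp only [← map_toMatrix_comparisonCircuit, List.getElem_map]
      rfl
    rw [HistoryTest.evolution, ← Matrix.mulVec_mulVec, ih (Nat.le_of_succ_le hj), hstep,
      ← List.take_append_getElem hlen, applyAll, applyAll, List.foldl_append]
    rfl

theorem evolution_comparisonTest_mulVec_eq_applyAll (C : List (Gate (Fin n)))
    (v : (CompQubit n → Bool) → ℂ) :
    (comparisonTest C).evolution (n + C.length + 3) *ᵥ v = applyAll (comparisonGates C) v := by
  rw [evolution_comparisonTest_mulVec C v le_rfl, List.take_of_length_le]
  rw [← map_toMatrix_comparisonCircuit, List.length_map, length_comparisonCircuit]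

end ComparisonCircuit

/-! ### The swap test -/

section SwapTest

theorem applyAll_append {B : Type} [Fintype B] (l l' : List (Matrix B B ℂ)) (v : B → ℂ) :
    applyAll (l ++ l') v = applyAll l' (applyAll l v) :=
  List.foldl_append

theorem applyAll_cons {B : Type} [Fintype B] (A : Matrix B B ℂ) (l : List (Matrix B B ℂ))
    (v : B → ℂ) : applyAll (A :: l) v = applyAll l (A *ᵥ v) :=
  rfl

theorem applyAll_smul {B : Type} [Fintype B] (l : List (Matrix B B ℂ)) (c : ℂ) (v : B → ℂ) :
    applyAll l (c • v) = c • applyAll l v := by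
  induction l generalizing v with
  | nil => rfl
  | cons A l ih => rw [applyAll_cons, applyAll_cons, Matrix.mulVec_smul, ih]

theorem sum_norm_sq_mulVec {B : Type} [Fintype B] [DecidableEq B] {U : Matrix B B ℂ}
    (hU : U ∈ Matrix.unitaryGroup B ℂ) (v : B → ℂ) :
    ∑ x, ‖(U *ᵥ v) x‖ ^ 2 = ∑ x, ‖v x‖ ^ 2 := by
  have hcol (w : B → ℂ) : ∑ x, ‖w x‖ ^ 2 = ‖Matrix.replicateCol Unit w‖ ^ 2 := by
    rw [Matrix.frobenius_norm_replicateCol, EuclideanSpace.norm_sq_eq]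
  rw [hcol, hcol, Matrix.replicateCol_mulVec, frobenius_norm_unitary_mul hU]

theorem sum_norm_sq_applyAll {B : Type} [Fintype B] [DecidableEq B] {l : List (Matrix B B ℂ)}
    (hl : ∀ U ∈ l, U ∈ Matrix.unitaryGroup B ℂ) (v : B → ℂ) :
    ∑ x, ‖applyAll l v x‖ ^ 2 = ∑ x, ‖v x‖ ^ 2 := by
  induction l generalizing v with
  | nil => rfl
  | cons U l ih =>
    rw [applyAll_cons, ih fun V hV => hl V (List.mem_cons_of_mem _ hV),
      sum_norm_sq_mulVec (hl U List.mem_cons_self)]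

variable {n : ℕ}

/-- The basis state with contents `o`, `a`, `b` of the registers `out`, `adv`, `aux`. -/
def compState (o : Bool) (a b : Fin n → Bool) : CompQubit n → Bool :=
  Sum.elim (fun _ => o) (Sum.elim a b)

theorem sum_compState {M : Type*} [AddCommMonoid M] (F : (CompQubit n → Bool) → M) :
    ∑ d, F d = ∑ o, ∑ a, ∑ b, F (compState o a b) := by
  rw [sum_sum_elim, ← (Equiv.funUnique Unit Bool).symm.sum_comp]
  exact Finset.sum_congr rfl fun o _ => sum_sum_elim _

theorem toMatrix_map_auxEmb_compState (g : Gate (Fin n)) (o o' : Bool)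
    (a a' b b' : Fin n → Bool) :
    (g.map (auxEmb n)).toMatrix (compState o a b) (compState o' a' b') =
      if o = o' ∧ a = a' then g.toMatrix b b' else 0 := by
  classical
  have hmem (i : Fin n) : CompQubit.aux i ∈ Set.range (g.map (auxEmb n)).wires ↔
      i ∈ Set.range g.wires :=
    exists_congr fun _ => (auxEmb n).injective.eq_iff
  have hiff : (∀ i ∉ Set.range (g.map (auxEmb n)).wires,
      compState o a b i = compState o' a' b' i) ↔
      (o = o' ∧ a = a') ∧ ∀ i ∉ Set.range g.wires, b i = b' i := by
    rw [Sum.forall, Sum.forall, funext_iff, and_assoc]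
    refine and_congr (Unique.forall_iff.trans (imp_iff_right ?_))
      (and_congr (forall_congr' fun i => imp_iff_right ?_)
      (forall_congr' fun i => imp_congr_left (not_congr (hmem i))))
    · rintro ⟨a, h⟩
      exact Sum.inr_ne_inl h
    · rintro ⟨a, h⟩
      exact Sum.inr_ne_inl (Sum.inr_injective h)
  rw [Gate.toMatrix, Gate.toMatrix]
  by_cases h : o = o' ∧ a = a' <;> by_cases hb : ∀ i ∉ Set.range g.wires, b i = b' i
  · rw [if_pos (hiff.2 ⟨h, hb⟩), if_pos h, if_pos hb]
    rfl
  · rw [if_neg fun hall => hb (hiff.1 hall).2, if_pos h, if_neg hb]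
  all_goals rw [if_neg fun hall => h (hiff.1 hall).1, if_neg h]

theorem toMatrix_map_auxEmb_mulVec (g : Gate (Fin n)) (v : (CompQubit n → Bool) → ℂ) (o : Bool)
    (a b : Fin n → Bool) :
    ((g.map (auxEmb n)).toMatrix *ᵥ v) (compState o a b) =
      (g.toMatrix *ᵥ fun b' => v (compState o a b')) b := by
  simp only [Matrix.mulVec, dotProduct, sum_compState, toMatrix_map_auxEmb_compState]
  rw [Fintype.sum_eq_single o, Fintype.sum_eq_single a]
  · simp only [and_self, if_true]
  · intro a' ha'
    simp only [ha'.symm, and_false, if_false, zero_mul, Finset.sum_const_zero]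
  · intro o' ho'
    simp only [ho'.symm, false_and, if_false, zero_mul, Finset.sum_const_zero]

theorem applyAll_map_auxEmb (C : List (Gate (Fin n))) (v : (CompQubit n → Bool) → ℂ) (o : Bool)
    (a b : Fin n → Bool) :
    applyAll (C.map fun g => (g.map (auxEmb n)).toMatrix) v (compState o a b) =
      applyAll (C.map Gate.toMatrix) (fun b' => v (compState o a b')) b := by
  induction C generalizing v with
  | nil => rfl
  | cons g C ih =>
    rw [List.map_cons, List.map_cons, applyAll_cons, applyAll_cons, ih]
    simp only [toMatrix_map_auxEmb_mulVec]

theorem hadamardOut_compState (o o' : Bool) (a a' b b' : Fin n → Bool) :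
    hadamardOut n (compState o a b) (compState o' a' b') =
      if a = a' ∧ b = b' then (1 / (√2 : ℝ) : ℂ) * (if o && o' then -1 else 1) else 0 := by
  have hiff : (∀ i, i ≠ CompQubit.out → compState o a b i = compState o' a' b' i) ↔
      a = a' ∧ b = b' := by
    rw [Sum.forall, Sum.forall, funext_iff, funext_iff]
    exact (and_iff_right fun _ h => (h rfl).elim).trans (and_congr
      (forall_congr' fun _ => imp_iff_right Sum.inr_ne_inl)
      (forall_congr' fun _ => imp_iff_right Sum.inr_ne_inl))
  rw [hadamardOut]
  by_cases h : a = a' ∧ b = b'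
  · rw [if_pos (hiff.2 h), if_pos h]
    rfl
  · rw [if_neg fun hall => h (hiff.1 hall), if_neg h]

theorem hadamardOut_mulVec (v : (CompQubit n → Bool) → ℂ) (o : Bool) (a b : Fin n → Bool) :
    (hadamardOut n *ᵥ v) (compState o a b) = ((√2 : ℝ) : ℂ)⁻¹ *
      (v (compState false a b) + (if o then -1 else 1) * v (compState true a b)) := by
  have hsum (o' : Bool) : ∑ a', ∑ b', hadamardOut n (compState o a b) (compState o' a' b') *
      v (compState o' a' b') = (1 / (√2 : ℝ) : ℂ) * (if o && o' then -1 else 1) *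
        v (compState o' a b) := by
    simp only [hadamardOut_compState]
    rw [Fintype.sum_eq_single a, Fintype.sum_eq_single b]
    · simp only [and_self, if_true]
    · intro b' hb'
      simp only [hb'.symm, and_false, if_false, zero_mul]
    · intro a' ha'
      simp only [ha'.symm, false_and, if_false, zero_mul, Finset.sum_const_zero]
  rw [Matrix.mulVec, dotProduct, sum_compState, Fintype.sum_bool, hsum, hsum, Bool.and_true,
    Bool.and_false, if_neg Bool.false_ne_true]
  ring

theorem notOut_mulVec (v : (CompQubit n → Bool) → ℂ) (o : Bool) (a b : Fin n → Bool) :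
    (notOut n *ᵥ v) (compState o a b) = v (compState (!o) a b) := by
  rw [notOut_eq_permMatrix, Matrix.permMatrix_mulVec]
  refine congrArg v (funext fun i => ?_)
  rw [flipOut_apply]
  rcases i with _ | i
  · exact Function.update_self CompQubit.out _ _
  · exact Function.update_of_ne Sum.inr_ne_inl _ _

theorem applyAll_map_cswap (l : List (Fin n)) (v : (CompQubit n → Bool) → ℂ)
    (d : CompQubit n → Bool) :
    applyAll (l.map cswap) v d = v (l.foldr (fun i => condSwap i) d) := by
  induction l generalizing v with
  | nil => rfl
  | cons i l ih =>
    rw [List.map_cons, applyAll_cons, ih, cswap_eq_permMatrix, Matrix.permMatrix_mulVec]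
    rfl

theorem foldr_condSwap_false (l : List (Fin n)) (a b : Fin n → Bool) :
    l.foldr (fun i => condSwap i) (compState false a b) = compState false a b := by
  induction l with
  | nil => rfl
  | cons i l ih =>
    rw [List.foldr_cons, ih]
    rfl

theorem foldr_condSwap_true {l : List (Fin n)} (hl : l.Nodup) (a b : Fin n → Bool) :
    l.foldr (fun i => condSwap i) (compState true a b) =
      compState true (fun i => if i ∈ l then b i else a i) fun i => if i ∈ l then a i else b i := by
  induction l with
  | nil => simp
  | cons j l ih =>
    obtain ⟨hj, hl⟩ := List.nodup_cons.1 hl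
    rw [List.foldr_cons, ih hl, condSwap_apply]
    change (if true = true then _ else _) = _
    rw [if_pos rfl]
    ext (u | i | i)
    · rfl
    all_goals
      by_cases hij : i = j
      · subst hij
        simp [compState, hj]
      · simp [compState, hij, Equiv.swap_apply_of_ne_of_ne]

theorem applyAll_cswap (v : (CompQubit n → Bool) → ℂ) (o : Bool) (a b : Fin n → Bool) :
    applyAll (List.ofFn fun i => cswap i) v (compState o a b) =
      v (if o then compState true b a else compState false a b) := by
  rw [List.ofFn_eq_map, applyAll_map_cswap]
  cases o
  · rw [foldr_condSwap_false, if_neg Bool.false_ne_true]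
  · simp only [foldr_condSwap_true (List.nodup_finRange n), List.mem_finRange, if_true]

theorem inputState_compState (ψ : (Fin n → Bool) → ℂ) (o : Bool) (a b : Fin n → Bool) :
    inputState ψ (compState o a b) = if o = false ∧ b = fun _ => false then ψ a else 0 := by
  have hiff : compState o a b = compInput a ↔ o = false ∧ b = fun _ => false := by
    rw [compState, compInput, Sum.elim_eq_iff, Sum.elim_eq_iff]
    simp [funext_iff]
  rw [inputState]
  exact if_congr hiff rfl rfl

theorem applyAll_map_auxEmb_inputState (C : List (Gate (Fin n))) (ψ : (Fin n → Bool) → ℂ)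
    (o : Bool) (a b : Fin n → Bool) :
    applyAll (C.map fun g => (g.map (auxEmb n)).toMatrix) (inputState ψ) (compState o a b) =
      (if o then 0 else ψ a) * circuitState C b := by
  have hinput : (fun b' => inputState ψ (compState o a b')) =
      (if o then 0 else ψ a) • Pi.single (fun _ => false) 1 := by
    ext b'
    cases o <;> simp [inputState_compState, Pi.single_apply]
  rw [applyAll_map_auxEmb, hinput, applyAll_smul]
  rfl

theorem applyAll_comparisonGates_inputState (C : List (Gate (Fin n))) (ψ : (Fin n → Bool) → ℂ)
    (a b : Fin n → Bool) :
    applyAll (comparisonGates C) (inputState ψ) (compState false a b) =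
      (ψ a * circuitState C b - circuitState C a * ψ b) / 2 := by
  rw [comparisonGates, applyAll_append, applyAll_append, applyAll_append]
  change (notOut n *ᵥ (hadamardOut n *ᵥ applyAll (List.ofFn fun i => cswap i)
    (hadamardOut n *ᵥ applyAll (C.map fun g => (g.map (auxEmb n)).toMatrix) (inputState ψ))))
      (compState false a b) = _
  simp only [notOut_mulVec, hadamardOut_mulVec, applyAll_cswap, applyAll_map_auxEmb_inputState,
    Bool.not_false, if_true, Bool.false_eq_true, if_false]
  linear_combination (ψ a * circuitState C b - circuitState C a * ψ b) * inv_sqrt_two_mul_self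

/-- The inputs of the comparison circuit with the columns of `Ψ` in the register `adv`. -/
def inputEnsemble {I : Type} (Ψ : Matrix (Fin n → Bool) I ℂ) : Matrix (CompQubit n → Bool) I ℂ :=
  Matrix.of fun d i => inputState (Ψ.col i) d

theorem compInput_injective : Function.Injective (compInput (n := n)) := fun _ _ h =>
  funext fun i => congrFun h (CompQubit.adv i)

theorem inputEnsemble_compInput {I : Type} (Ψ : Matrix (Fin n → Bool) I ℂ) (x : Fin n → Bool) :
    inputEnsemble Ψ (compInput x) = Ψ x :=
  funext fun _ => if_pos rfl

theorem inputEnsemble_of_notMem {I : Type} (Ψ : Matrix (Fin n → Bool) I ℂ)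
    {d : CompQubit n → Bool} (hd : d ∉ Set.range compInput) : inputEnsemble Ψ d = 0 :=
  funext fun _ => if_neg fun h => hd ⟨_, h.symm⟩

theorem rowProj_range_compInput {I : Type} (A : Matrix (CompQubit n → Bool) I ℂ) :
    rowProj (Set.range compInput) A = inputEnsemble (A.submatrix compInput id) := by
  ext d i
  by_cases hd : d ∈ Set.range compInput
  · obtain ⟨x, rfl⟩ := hd
    rw [inputEnsemble_compInput]
    exact congrFun (Set.indicator_of_mem (Set.mem_range_self x) A) i
  · rw [inputEnsemble_of_notMem _ hd]
    exact congrFun (Set.indicator_of_notMem hd A) i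

variable {I : Type} [Fintype I]

theorem sum_norm_sq_circuitState (C : List (Gate (Fin n))) : ∑ x, ‖circuitState C x‖ ^ 2 = 1 := by
  rw [circuitState, sum_norm_sq_applyAll]
  · simp [Pi.single_apply, apply_ite]
  · intro U hU
    obtain ⟨g, -, rfl⟩ := List.mem_map.1 hU
    exact g.toMatrix_mem_unitaryGroup

theorem norm_inputEnsemble (Ψ : Matrix (Fin n → Bool) I ℂ) : ‖inputEnsemble Ψ‖ = ‖Ψ‖ := by
  rw [← sq_eq_sq₀ (norm_nonneg _) (norm_nonneg _), frobenius_norm_sq, frobenius_norm_sq]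
  refine (Fintype.sum_of_injective compInput compInput_injective _ _ (fun d hd => ?_)
    fun x => ?_).symm
  · simp [inputEnsemble_of_notMem _ hd]
  · rw [inputEnsemble_compInput]

theorem sum_norm_sq_antisymm {X : Type*} [Fintype X] (ψ χ : X → ℂ) :
    ∑ a, ∑ b, ‖(ψ a * χ b - χ a * ψ b) / 2‖ ^ 2 =
      ((∑ a, ‖ψ a‖ ^ 2) * (∑ a, ‖χ a‖ ^ 2) - ‖∑ a, star (χ a) * ψ a‖ ^ 2) / 2 := by
  have hterm (a b : X) : ‖(ψ a * χ b - χ a * ψ b) / 2‖ ^ 2 =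
      (‖ψ a‖ ^ 2 * ‖χ b‖ ^ 2 + ‖χ a‖ ^ 2 * ‖ψ b‖ ^ 2 -
        2 * ((star (χ a) * ψ a) * star (star (χ b) * ψ b)).re) / 4 := by
    rw [norm_div, div_pow, Complex.sq_norm, Complex.normSq_sub]
    simp only [map_mul, ← Complex.sq_norm, Complex.norm_ofNat, Complex.star_def, Complex.conj_conj]
    ring_nf
  have hoverlap : ∑ a, ∑ b, ((star (χ a) * ψ a) * star (star (χ b) * ψ b)).re =
      ‖∑ a, star (χ a) * ψ a‖ ^ 2 := by
    simp only [← Complex.re_sum, ← Finset.mul_sum, ← Finset.sum_mul, ← star_sum]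
    rw [Complex.star_def, Complex.mul_conj, Complex.ofReal_re, Complex.sq_norm]
  simp only [hterm, ← Finset.sum_div, Finset.sum_sub_distrib, Finset.sum_add_distrib,
    ← Finset.mul_sum, ← Finset.sum_mul, hoverlap]
  ring

theorem norm_rowProj_out_comparisonTest_sq (C : List (Gate (Fin n)))
    (Ψ : Matrix (Fin n → Bool) I ℂ) :
    ‖rowProj (comparisonTest C).acceptᶜ
        ((comparisonTest C).evolution (n + C.length + 3) * inputEnsemble Ψ)‖ ^ 2 =
      (‖Ψ‖ ^ 2 - ∑ i, ‖∑ x, star (circuitState C x) * Ψ x i‖ ^ 2) / 2 := by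
  have hcol (d : CompQubit n → Bool) (i : I) :
      ((comparisonTest C).evolution (n + C.length + 3) * inputEnsemble Ψ) d i =
        applyAll (comparisonGates C) (inputState (Ψ.col i)) d := by
    rw [← evolution_comparisonTest_mulVec_eq_applyAll]
    rfl
  have htrue (a b : Fin n → Bool) : compState true a b ∉ (comparisonTest C).acceptᶜ :=
    fun h => h rfl
  have hfalse (a b : Fin n → Bool) : compState false a b ∈ (comparisonTest C).acceptᶜ :=
    Bool.false_ne_true
  simp only [norm_rowProj_sq, eventProb, sum_compState, Fintype.sum_bool, hcol,
    Set.indicator_of_notMem (htrue _ _), Set.indicator_of_mem (hfalse _ _),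
    applyAll_comparisonGates_inputState, Finset.sum_const_zero, zero_add]
  calc ∑ a, ∑ b, ∑ i, ‖(Ψ a i * circuitState C b - circuitState C a * Ψ b i) / 2‖ ^ 2
    _ = ∑ i, ∑ a, ∑ b, ‖(Ψ a i * circuitState C b - circuitState C a * Ψ b i) / 2‖ ^ 2 :=
       (Finset.sum_congr rfl fun _ _ => Finset.sum_comm).trans Finset.sum_comm
    _ = ∑ i, (∑ a, ‖Ψ a i‖ ^ 2 - ‖∑ x, star (circuitState C x) * Ψ x i‖ ^ 2) / 2 := by
      simp only [sum_norm_sq_antisymm (fun x => Ψ x _), sum_norm_sq_circuitState, mul_one]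
    _ = (‖Ψ‖ ^ 2 - ∑ i, ‖∑ x, star (circuitState C x) * Ψ x i‖ ^ 2) / 2 := by
      rw [frobenius_norm_sq, ← Finset.sum_div, Finset.sum_sub_distrib, Finset.sum_comm]

end SwapTest

section Hellinger

variable {B : Type} [Fintype B]

theorem hellinger_sq {P Q : B → ℝ} (hP : P ∈ stdSimplex ℝ B) (hQ : Q ∈ stdSimplex ℝ B) :
    hellinger P Q ^ 2 = 1 - ∑ x, √(P x) * √(Q x) := by
  have hterm (x : B) : (√(P x) - √(Q x)) ^ 2 = P x + Q x - 2 * (√(P x) * √(Q x)) := by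
    rw [sub_sq, Real.sq_sqrt (hP.1 x), Real.sq_sqrt (hQ.1 x)]
    ring
  rw [hellinger, mul_pow, Real.sq_sqrt (Finset.sum_nonneg fun _ _ => sq_nonneg _), div_pow,
    Real.sq_sqrt zero_le_two]
  simp only [hterm, Finset.sum_sub_distrib, Finset.sum_add_distrib, hP.2, hQ.2, ← Finset.mul_sum]
  ring

theorem hellinger_nonneg (P Q : B → ℝ) : 0 ≤ hellinger P Q :=
  mul_nonneg (by positivity) (Real.sqrt_nonneg _)

theorem sum_norm_sq_sum_mul_le {I : Type} [Fintype I] (c : B → ℂ) (Ψ : Matrix B I ℂ) :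
    ∑ i, ‖∑ x, c x * Ψ x i‖ ^ 2 ≤ (∑ x, ‖c x‖ * √(∑ i, ‖Ψ x i‖ ^ 2)) ^ 2 := by
  let row (x : B) : EuclideanSpace ℂ I := WithLp.toLp 2 (Ψ x)
  calc ∑ i, ‖∑ x, c x * Ψ x i‖ ^ 2 = ‖∑ x, c x • row x‖ ^ 2 := by
        simp [EuclideanSpace.norm_sq_eq, row]
    _ ≤ (∑ x, ‖c x • row x‖) ^ 2 := by gcongr; exact norm_sum_le _ _
    _ = (∑ x, ‖c x‖ * √(∑ i, ‖Ψ x i‖ ^ 2)) ^ 2 := by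
        simp only [norm_smul, EuclideanSpace.norm_eq, row]

theorem hellinger_sq_le_of_overlap {I : Type} [Fintype I] {χ : B → ℂ} (hχ : ∑ x, ‖χ x‖ ^ 2 = 1)
    {Ψ : Matrix B I ℂ} (hΨ : 0 < ‖Ψ‖) {κ : ℝ}
    (h : ‖Ψ‖ ^ 2 - ∑ i, ‖∑ x, star (χ x) * Ψ x i‖ ^ 2 ≤ κ * ‖Ψ‖ ^ 2) :
    hellinger (fun x => ‖χ x‖ ^ 2) (fun x => (∑ i, ‖Ψ x i‖ ^ 2) / ‖Ψ‖ ^ 2) ^ 2 ≤ κ := by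
  have hP : (fun x => ‖χ x‖ ^ 2) ∈ stdSimplex ℝ B := ⟨fun _ => sq_nonneg _, hχ⟩
  have hQ : (fun x => (∑ i, ‖Ψ x i‖ ^ 2) / ‖Ψ‖ ^ 2) ∈ stdSimplex ℝ B := by
    refine ⟨fun _ => by positivity, ?_⟩
    rw [← Finset.sum_div, ← frobenius_norm_sq, div_self (by positivity)]
  have hsq := hellinger_sq hP hQ
  have hH := sq_nonneg (hellinger (fun x => ‖χ x‖ ^ 2) fun x => (∑ i, ‖Ψ x i‖ ^ 2) / ‖Ψ‖ ^ 2)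
  rw [hsq] at hH ⊢
  set bc := ∑ x, √(‖χ x‖ ^ 2) * √((∑ i, ‖Ψ x i‖ ^ 2) / ‖Ψ‖ ^ 2) with hbc
  have hbc0 : 0 ≤ bc := Finset.sum_nonneg fun _ _ => by positivity
  have hoverlap : ∑ i, ‖∑ x, star (χ x) * Ψ x i‖ ^ 2 ≤ bc ^ 2 * ‖Ψ‖ ^ 2 := by
    refine (sum_norm_sq_sum_mul_le _ Ψ).trans_eq ?_
    rw [← mul_pow, hbc, Finset.sum_mul]
    congr! 2 with x
    rw [Real.sqrt_sq (norm_nonneg _), norm_star, Real.sqrt_div' _ (sq_nonneg _),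
      Real.sqrt_sq hΨ.le, mul_assoc, div_mul_cancel₀ _ hΨ.ne']
  have hκ : 1 - bc ^ 2 ≤ κ := by
    refine le_of_mul_le_mul_right ?_ (pow_pos hΨ 2)
    linarith
  nlinarith

end Hellinger

section LowEnergy

variable {n : ℕ} {C : List (Gate (Fin n))} {η : ℝ}

theorem unary_zero (m : ℕ) : unary m 0 = fun _ => false :=
  funext fun i => decide_eq_false i.val.not_lt_zero

theorem advWeight_eq {T : ℕ} (ρ : Matrix (MsgQubit n T → Bool) (MsgQubit n T → Bool) ℂ)
    (x : Fin n → Bool) : advWeight ρ x =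
      (ρ (timeState (n + T + 3) 0 (compInput x)) (timeState (n + T + 3) 0 (compInput x))).re := by
  rw [advWeight, timeState, unary_zero]

theorem advWeight_mul_conjTranspose {T : ℕ} {I : Type} [Fintype I]
    (Φ : Matrix (MsgQubit n T → Bool) I ℂ) (x : Fin n → Bool) :
    advWeight (Φ * Φᴴ) x = ∑ i, ‖slice Φ 0 (compInput x) i‖ ^ 2 := by
  rw [advWeight_eq, mul_conjTranspose_apply_self_re]
  rfl

theorem hellinger_circuitDist_advDist_le
    {ρ : Matrix (MsgQubit n C.length → Bool) (MsgQubit n C.length → Bool) ℂ} (hρ : IsDensity ρ)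
    (hη : 0 < η) (hη' : η ≤ 1 / 100)
    (hE : (comparisonTest C).energy ρ ≤ 3 * (η / ((n + C.length + 3 : ℕ) + 1)) ^ 2) :
    0 < advProb ρ ∧ hellinger (circuitDist C) (advDist ρ) ≤ 20 * η := by
  obtain ⟨Φ, rfl⟩ := exists_eq_mul_conjTranspose hρ.1
  obtain ⟨hpos, hout⟩ :=
    (comparisonTest C).norm_rowProj_accept_compl_le_of_energy_le hρ hη hη' hE
  set Ψ : Matrix (Fin n → Bool) _ ℂ := (slice Φ 0).submatrix compInput id with hΨ
  have hinput : rowProj (comparisonTest C).input (slice Φ 0) = inputEnsemble Ψ :=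
    rowProj_range_compInput _
  rw [hinput, norm_inputEnsemble] at hpos hout
  have hprob : advProb (Φ * Φᴴ) = ‖Ψ‖ ^ 2 := by
    simp only [advProb, advWeight_mul_conjTranspose, frobenius_norm_sq]
    rfl
  have hdist : advDist (Φ * Φᴴ) = fun x => (∑ i, ‖Ψ x i‖ ^ 2) / ‖Ψ‖ ^ 2 := by
    ext x
    rw [advDist, hprob, advWeight_mul_conjTranspose]
    rfl
  have hoverlap : ‖Ψ‖ ^ 2 - ∑ i, ‖∑ x, star (circuitState C x) * Ψ x i‖ ^ 2 ≤
      (20 * η) ^ 2 * ‖Ψ‖ ^ 2 := by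
    have hsq := pow_le_pow_left₀ (norm_nonneg _) hout 2
    rw [norm_rowProj_out_comparisonTest_sq] at hsq
    nlinarith [mul_nonneg (sq_nonneg η) (sq_nonneg ‖Ψ‖)]
  refine ⟨by rw [hprob]; positivity, ?_⟩
  rw [hdist]
  exact (sq_le_sq₀ (hellinger_nonneg _ _) (by positivity)).1
    (hellinger_sq_le_of_overlap (sum_norm_sq_circuitState C) hpos hoverlap)

end LowEnergy

/-! ### History states -/

theorem isDensity_mul_conjTranspose {X I : Type} [Fintype X] [Fintype I] {Φ : Matrix X I ℂ}
    (hΦ : ‖Φ‖ = 1) : IsDensity (Φ * Φᴴ) := by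
  have hpsd := Matrix.posSemidef_self_mul_conjTranspose Φ
  refine ⟨hpsd, Complex.ext ?_ (Complex.nonneg_iff.1 hpsd.trace_nonneg).2.symm⟩
  rw [← frobenius_norm_sq_eq_trace, hΦ, one_pow, Complex.one_re]

theorem pureState_eq_replicateCol_mul {X : Type} (φ : X → ℂ) :
    pureState φ = Matrix.replicateCol Unit φ * (Matrix.replicateCol Unit φ)ᴴ := by
  rw [pureState, Matrix.vecMulVec_eq Unit, Matrix.conjTranspose_replicateCol]

theorem norm_replicateCol_sq {X : Type} [Fintype X] (φ : X → ℂ) :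
    ‖Matrix.replicateCol Unit φ‖ ^ 2 = ∑ x, ‖φ x‖ ^ 2 := by
  rw [Matrix.frobenius_norm_replicateCol, EuclideanSpace.norm_sq_eq]

section Slices

variable {m : ℕ} {ι I : Type} [Fintype ι] [DecidableEq ι] [Fintype I]
  {Φ : Matrix (Fin m ⊕ ι → Bool) I ℂ}

theorem norm_sq_eq_sum_slice (hΦ : ∀ z, z ∘ Sum.inl ∉ unary m '' Set.Iic m → Φ z = 0) :
    ‖Φ‖ ^ 2 = ∑ j ∈ Finset.range (m + 1), ‖slice Φ j‖ ^ 2 := by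
  have hlegal (z : Fin m ⊕ ι → Bool) : ∑ i, ‖Φ z i‖ ^ 2 =
      ∑ j ∈ Finset.range (m + 1), if z ∘ Sum.inl = unary m j then ∑ i, ‖Φ z i‖ ^ 2 else 0 := by
    by_cases hz : z ∘ Sum.inl ∈ unary m '' Set.Iic m
    · obtain ⟨j, hj, hz⟩ := hz
      rw [Finset.sum_eq_single_of_mem j (Finset.mem_range_succ_iff.2 hj) fun j' hj' hne =>
        if_neg fun h => hne (unary_injOn m (Finset.mem_range_succ_iff.1 hj') hj
          (h.symm.trans hz.symm)), if_pos hz.symm]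
    · simp [hΦ z hz]
  simp only [frobenius_norm_sq]
  rw [Finset.sum_congr rfl fun z _ => hlegal z, Finset.sum_comm]
  exact Finset.sum_congr rfl fun j _ => sum_clock_eq j fun z => ∑ i, ‖Φ z i‖ ^ 2

variable {θ : HistoryTest m ι} {u : Matrix (ι → Bool) I ℂ} {c : ℂ}

theorem HistoryTest.sum_norm_slice_sq
    (hslice : ∀ j ≤ m, slice Φ j = c • (θ.evolution j * u)) (hc : ‖c‖ ^ 2 = (m + 1 : ℝ)⁻¹) :
    ∑ j ∈ Finset.range (m + 1), ‖slice Φ j‖ ^ 2 = ‖u‖ ^ 2 := by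
  have hterm : ∀ j ∈ Finset.range (m + 1), ‖slice Φ j‖ ^ 2 = (m + 1 : ℝ)⁻¹ * ‖u‖ ^ 2 := by
    intro j hj
    rw [hslice j (Finset.mem_range_succ_iff.1 hj), norm_smul, mul_pow, hc,
      frobenius_norm_unitary_mul (θ.evolution_mem_unitaryGroup j)]
  rw [Finset.sum_congr rfl hterm, Finset.sum_const, Finset.card_range, nsmul_eq_mul,
    Nat.cast_succ, mul_inv_cancel_left₀ (by positivity)]

theorem HistoryTest.energy_eq_of_slice_eq
    (hslice : ∀ j ≤ m, slice Φ j = c • (θ.evolution j * u)) (hc : ‖c‖ ^ 2 = (m + 1 : ℝ)⁻¹)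
    (hu : ‖u‖ = 1) (hin : rowProj θ.inputᶜ u = 0) :
    θ.energy (Φ * Φᴴ) =
      ((m + 1 : ℝ)⁻¹) ^ 2 * ‖rowProj θ.acceptᶜ (θ.evolution m * u)‖ ^ 2 := by
  have hproj (E : Set (ι → Bool)) (A : Matrix (ι → Bool) I ℂ) :
      rowProj E (c • A) = c • rowProj E A := Set.indicator_const_smul E c A
  have hgate : ∀ j ∈ Finset.range m, ‖slice Φ (j + 1) - θ.step j * slice Φ j‖ ^ 2 = 0 := by
    intro j hj
    have hj := Finset.mem_range.1 hj
    rw [hslice _ hj, hslice _ hj.le, Matrix.mul_smul, ← Matrix.mul_assoc, evolution, sub_self,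
      norm_zero, zero_pow two_ne_zero]
  rw [energy_mul_conjTranspose, sum_norm_slice_sq hslice hc, Finset.sum_eq_zero hgate,
    hslice 0 m.zero_le, hslice m le_rfl, evolution, Matrix.one_mul, hproj, hproj, hin, hu,
    smul_zero, norm_zero, norm_smul, mul_pow, hc]
  ring

end Slices

variable {n : ℕ} (C : List (Gate (Fin n))) (ψ : (Fin n → Bool) → ℂ)

theorem historyState_eq_zero {z : MsgQubit n C.length → Bool}
    (hz : z ∘ Sum.inl ∉ unary (n + C.length + 3) '' Set.Iic (n + C.length + 3)) :
    historyState C ψ z = 0 := by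
  rw [historyState, Finset.sum_eq_zero, mul_zero]
  exact fun j hj => if_neg fun h => hz ⟨j, Finset.mem_range_succ_iff.1 hj, h.symm⟩

theorem historyState_timeState {j : ℕ} (hj : j ≤ n + C.length + 3) (d : CompQubit n → Bool) :
    historyState C ψ (timeState (n + C.length + 3) j d) =
      (1 / (√((n + C.length + 3 : ℕ) + 1 : ℝ) : ℝ) : ℂ) *
        applyAll ((comparisonGates C).take j) (inputState ψ) d := by
  rw [historyState, Finset.sum_eq_single_of_mem j (Finset.mem_range_succ_iff.2 hj)]
  · exact congrArg _ (if_pos rfl)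
  · exact fun j' hj' hne =>
      if_neg fun h => hne (unary_injOn _ (Finset.mem_range_succ_iff.1 hj') hj h.symm)

theorem slice_historyState {j : ℕ} (hj : j ≤ n + C.length + 3) :
    slice (Matrix.replicateCol Unit (historyState C ψ)) j =
      (1 / (√((n + C.length + 3 : ℕ) + 1 : ℝ) : ℝ) : ℂ) •
        ((comparisonTest C).evolution j * inputEnsemble (Matrix.replicateCol Unit ψ)) := by
  ext d i
  rw [Matrix.smul_apply, smul_eq_mul, slice, Matrix.submatrix_apply, Matrix.replicateCol_apply,
    historyState_timeState C ψ hj, ← evolution_comparisonTest_mulVec C _ hj]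
  rfl

theorem norm_sq_historyState_coeff (m : ℕ) :
    ‖(1 / (√(m + 1 : ℝ) : ℝ) : ℂ)‖ ^ 2 = (m + 1 : ℝ)⁻¹ := by
  rw [norm_div, norm_one, Complex.norm_real, Real.norm_eq_abs, div_pow, sq_abs,
    Real.sq_sqrt (by positivity), one_pow, one_div]

theorem advWeight_historyState (x : Fin n → Bool) :
    advWeight (pureState (historyState C ψ)) x =
      ((n + C.length + 3 : ℕ) + 1 : ℝ)⁻¹ * ‖ψ x‖ ^ 2 := by
  rw [pureState_eq_replicateCol_mul, advWeight_mul_conjTranspose,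
    slice_historyState C ψ (Nat.zero_le _), HistoryTest.evolution, Matrix.one_mul,
    Finset.univ_unique, Finset.sum_singleton, Matrix.smul_apply, inputEnsemble_compInput,
    norm_smul, mul_pow, norm_sq_historyState_coeff, Matrix.replicateCol_apply]

variable {ψ}

theorem isDensity_historyState (hψ : ∑ x, ‖ψ x‖ ^ 2 = 1) :
    IsDensity (pureState (historyState C ψ)) := by
  rw [pureState_eq_replicateCol_mul]
  have hclock : ∀ z : MsgQubit n C.length → Bool,
      z ∘ Sum.inl ∉ unary (n + C.length + 3) '' Set.Iic (n + C.length + 3) →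
        Matrix.replicateCol Unit (historyState C ψ) z = 0 :=
    fun z hz => funext fun _ => historyState_eq_zero C ψ hz
  refine isDensity_mul_conjTranspose ?_
  rw [← sq_eq_sq₀ (norm_nonneg _) zero_le_one, norm_sq_eq_sum_slice hclock,
    HistoryTest.sum_norm_slice_sq (fun j hj => slice_historyState C ψ hj)
      (norm_sq_historyState_coeff _), norm_inputEnsemble, norm_replicateCol_sq, hψ, one_pow]

theorem energy_historyState (hψ : ∑ x, ‖ψ x‖ ^ 2 = 1) :
    (comparisonTest C).energy (pureState (historyState C ψ)) =
      (((n + C.length + 3 : ℕ) + 1 : ℝ)⁻¹) ^ 2 *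
        ((1 - ‖∑ x, star (circuitState C x) * ψ x‖ ^ 2) / 2) := by
  have hin : rowProj (comparisonTest C).inputᶜ (inputEnsemble (Matrix.replicateCol Unit ψ)) = 0 :=
    Set.indicator_eq_zero.2 (Set.disjoint_left.2 fun d hd hd' =>
      hd (inputEnsemble_of_notMem _ hd'))
  have hnorm : ‖inputEnsemble (Matrix.replicateCol Unit ψ)‖ = 1 := by
    rw [← sq_eq_sq₀ (norm_nonneg _) zero_le_one, norm_inputEnsemble, norm_replicateCol_sq, hψ,
      one_pow]
  rw [pureState_eq_replicateCol_mul, HistoryTest.energy_eq_of_slice_eq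
    (fun j hj => slice_historyState C ψ hj) (norm_sq_historyState_coeff _) hnorm hin,
    norm_rowProj_out_comparisonTest_sq, norm_replicateCol_sq, hψ, Finset.univ_unique,
    Finset.sum_singleton]
  rfl

section QuantumSample

variable {D : (Fin n → Bool) → ℝ}

theorem norm_sq_alignPhase_qsample (hD : D ∈ stdSimplex ℝ (Fin n → Bool)) (x : Fin n → Bool) :
    ‖alignPhase C (qsample D) x‖ ^ 2 = D x := by
  rw [alignPhase, norm_mul, Complex.norm_exp_ofReal_mul_I, one_mul, qsample, Complex.norm_real,
    Real.norm_eq_abs, sq_abs, Real.sq_sqrt (hD.1 x)]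

theorem sum_norm_sq_alignPhase_qsample (hD : D ∈ stdSimplex ℝ (Fin n → Bool)) :
    ∑ x, ‖alignPhase C (qsample D) x‖ ^ 2 = 1 := by
  simp only [norm_sq_alignPhase_qsample C hD, hD.2]

theorem star_circuitState_mul_alignPhase (D : (Fin n → Bool) → ℝ) (x : Fin n → Bool) :
    star (circuitState C x) * alignPhase C (qsample D) x =
      ((√(D x) * √(circuitDist C x) : ℝ) : ℂ) := by
  have hphase : star (circuitState C x) * Complex.exp ((circuitState C x).arg * Complex.I) =
      ‖circuitState C x‖ := by
    conv_lhs => rw [← Complex.norm_mul_exp_arg_mul_I (circuitState C x), Complex.star_def, map_mul,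
      Complex.conj_ofReal, mul_assoc, Complex.norm_mul_exp_arg_mul_I, Complex.conj_mul',
      Complex.norm_exp_ofReal_mul_I, Complex.ofReal_one, one_pow, mul_one]
  rw [alignPhase, ← mul_assoc, hphase, qsample, circuitDist, Real.sqrt_sq (norm_nonneg _),
    mul_comm, Complex.ofReal_mul]

theorem overlap_alignPhase_qsample (hD : D ∈ stdSimplex ℝ (Fin n → Bool)) :
    ∑ x, star (circuitState C x) * alignPhase C (qsample D) x =
      ((1 - hellinger D (circuitDist C) ^ 2 : ℝ) : ℂ) := by
  have hC : circuitDist C ∈ stdSimplex ℝ (Fin n → Bool) :=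
    ⟨fun _ => sq_nonneg _, sum_norm_sq_circuitState C⟩
  simp only [star_circuitState_mul_alignPhase, ← Complex.ofReal_sum]
  rw [hellinger_sq hD hC, sub_sub_cancel]

theorem energy_historyState_alignPhase_le (hD : D ∈ stdSimplex ℝ (Fin n → Bool)) {η : ℝ}
    (hη : hellinger D (circuitDist C) ≤ η) :
    (comparisonTest C).energy (pureState (historyState C (alignPhase C (qsample D)))) ≤
      (η / ((n + C.length + 3 : ℕ) + 1)) ^ 2 := by
  rw [energy_historyState C (sum_norm_sq_alignPhase_qsample C hD), overlap_alignPhase_qsample C hD,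
    Complex.norm_real, Real.norm_eq_abs, sq_abs, div_eq_inv_mul η, mul_pow]
  have hη2 := pow_le_pow_left₀ (hellinger_nonneg D (circuitDist C)) hη 2
  gcongr
  nlinarith [sq_nonneg (hellinger D (circuitDist C) ^ 2)]

theorem advProb_historyState (hψ : ∑ x, ‖ψ x‖ ^ 2 = 1) :
    advProb (pureState (historyState C ψ)) = ((n + C.length + 3 : ℕ) + 1 : ℝ)⁻¹ := by
  simp only [advProb, advWeight_historyState, ← Finset.mul_sum, hψ, mul_one]

theorem advDist_historyState_alignPhase (hD : D ∈ stdSimplex ℝ (Fin n → Bool)) :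
    advDist (pureState (historyState C (alignPhase C (qsample D)))) = D := by
  ext x
  rw [advDist, advProb_historyState C (sum_norm_sq_alignPhase_qsample C hD),
    advWeight_historyState, norm_sq_alignPhase_qsample C hD, mul_div_cancel_left₀]
  positivity

end QuantumSample

/-! ### The energy test -/

namespace HistoryTest

variable {m : ℕ} {ι : Type} {θ : HistoryTest m ι}

theorem penalty_timeState_zero [NeZero m] {d : ι → Bool} (hd : d ∈ θ.input) :
    θ.penalty (timeState m 0 d) = 0 := by
  have hclock (j : ℕ) (hj : j ≤ m) : timeState m 0 d ∘ Sum.inl = unary m j ↔ j = 0 :=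
    ⟨fun h => (unary_injOn m (Nat.zero_le m) hj h).symm, fun h => h ▸ rfl⟩
  have hsum : ∑ j ∈ Finset.range (m + 1),
      (if timeState m 0 d ∘ Sum.inl = unary m j then (1 : ℝ) else 0) = 1 := by
    rw [Finset.sum_congr rfl fun j hj =>
      if_congr (hclock j (Nat.lt_succ_iff.1 (Finset.mem_range.1 hj))) rfl rfl]
    simp
  rw [penalty, hsum, if_neg ((hclock m le_rfl).not.2 (NeZero.ne m))]
  simp [timeState, hd]

variable [Fintype ι] [DecidableEq ι] {k : ℕ}
  {ρ : Matrix (Fin m ⊕ ι → Bool) (Fin m ⊕ ι → Bool) ℂ} {s : ℝ}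

theorem mul_bound_le_two_mul_secondMoment_bound (hs : s ≤ 1) (m k : ℕ) :
    s * (6 * (m + 1) * (4 * 12 ^ k)) ≤ 2 * (22 * (m + 1) * (4 * 12 ^ k) ^ 2) := by
  have hpow : (1 : ℝ) ≤ 4 * 12 ^ k :=
    one_le_mul_of_one_le_of_one_le (by norm_num) (one_le_pow₀ (by norm_num))
  calc s * (6 * (m + 1) * (4 * 12 ^ k)) ≤ 1 * (44 * (m + 1) * (4 * 12 ^ k)) := by gcongr; norm_num
    _ ≤ 44 * (m + 1) * (4 * 12 ^ k) ^ 2 := by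
        rw [one_mul, sq]
        exact mul_le_mul_of_nonneg_left (le_mul_of_one_le_left (by positivity) hpow) (by positivity)
    _ = _ := by ring

theorem eventProb_sum_energyStat_ge_le [NeZero m] (hρ : IsDensity ρ)
    (hk : ∀ j, (θ.gate j).arity ≤ k) (hs : s ∈ Set.Icc 0 1) (hE : θ.energy ρ ≤ s) (N : ℕ) :
    eventProb (iidWeight (roundLaw ρ) N) {τ | N * (2 * s) ≤ ∑ r, θ.energyStat (τ r)} ≤
      Real.exp (-(N * (s ^ 2 / (4 * (22 * (m + 1) * (4 * 12 ^ k) ^ 2))))) := by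
  rw [two_mul]
  refine eventProb_sum_ge_le (roundLaw_mem_stdSimplex hρ) (abs_energyStat_le hk)
    (secondMoment_energyStat_le hρ hk) (by positivity) hs.1
    (mul_bound_le_two_mul_secondMoment_bound hs.2 m k) ((mean_energyStat hρ).trans_le hE) N

theorem eventProb_sum_energyStat_le_le [NeZero m] (hρ : IsDensity ρ)
    (hk : ∀ j, (θ.gate j).arity ≤ k) (hs : s ∈ Set.Icc 0 1) (hE : 3 * s ≤ θ.energy ρ) (N : ℕ) :
    eventProb (iidWeight (roundLaw ρ) N) {τ | ∑ r, θ.energyStat (τ r) ≤ N * (2 * s)} ≤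
      Real.exp (-(N * (s ^ 2 / (4 * (22 * (m + 1) * (4 * 12 ^ k) ^ 2))))) := by
  rw [show 2 * s = 3 * s - s by ring]
  refine eventProb_sum_le_le (roundLaw_mem_stdSimplex hρ) (abs_energyStat_le hk)
    (secondMoment_energyStat_le hρ hk) (by positivity) hs.1
    (mul_bound_le_two_mul_secondMoment_bound hs.2 m k) (hE.trans_eq (mean_energyStat hρ).symm) N

end HistoryTest

section EnergyVerifier

variable {n T : ℕ}

/-- The sample, if any, in the record of a round: the content of `adv`, if all the qubits are
measured in the `Z` basis and `clock`, `out` and `aux` are all zero. -/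
def roundSample :
    EnergyCoin (n + T + 3) (CompQubit n) × (MsgQubit n T → Bool) → Option (Fin n → Bool)
  | (none, b) =>
    if b = timeState (n + T + 3) 0 (compInput fun i => b (.inr (.adv i))) then
      some fun i => b (.inr (.adv i))
    else none
  | (some _, _) => none

theorem roundSample_eq_some_iff
    {ω : EnergyCoin (n + T + 3) (CompQubit n) × (MsgQubit n T → Bool)} {x : Fin n → Bool} :
    roundSample ω = some x ↔ ω = (none, timeState (n + T + 3) 0 (compInput x)) := by
  rcases ω with ⟨_ | c, b⟩
  · simp only [roundSample, Option.ite_none_right_eq_some, Option.some.injEq, Prod.mk.injEq,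
      true_and]
    constructor
    · rintro ⟨hb, rfl⟩
      exact hb
    · rintro rfl
      exact ⟨rfl, rfl⟩
  · simp [roundSample]

section RoundLaw

variable (ρ : Matrix (MsgQubit n T → Bool) (MsgQubit n T → Bool) ℂ)

theorem eventProb_roundSample_eq (x : Fin n → Bool) :
    eventProb (roundLaw ρ) {ω | roundSample ω = some x} = advWeight ρ x / 2 := by
  simp only [roundSample_eq_some_iff, Set.ofPred_eq_eq_singleton]
  rw [eventProb_singleton, roundLaw, coinBasis, born_Z, coinWeight, advWeight_eq]
  ring

theorem eventProb_roundSample_isSome :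
    eventProb (roundLaw ρ) {ω | (roundSample ω).isSome} = advProb ρ / 2 := by
  simp only [eventProb_isSome, eventProb_roundSample_eq, advProb, Finset.sum_div]

end RoundLaw

variable (C : List (Gate (Fin n)))

/-- The verifier that estimates the energy of the messages in `N` rounds, rejects if the estimate
exceeds `2 * s`, and otherwise outputs the samples in its record. -/
def energyVerifier (s : ℝ) (N : ℕ) : Verifier (MsgQubit n C.length) n where
  rounds := N
  Coin := EnergyCoin (n + C.length + 3) (CompQubit n)
  fintypeCoin := inferInstance
  coinDist := coinWeight
  coinDist_mem := coinWeight_mem_stdSimplex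
  basis := coinBasis
  output τ := if ∑ r, (comparisonTest C).energyStat (τ r) ≤ N * (2 * s)
    then some (samples roundSample τ) else none

variable {C} {ρ : Matrix (MsgQubit n C.length → Bool) (MsgQubit n C.length → Bool) ℂ}

theorem prob_energyVerifier (ρ : Matrix (MsgQubit n C.length → Bool) (MsgQubit n C.length → Bool) ℂ)
    (s : ℝ) (N : ℕ) (u : List (Fin n → Bool) → Prop) :
    (energyVerifier C s N).prob ρ {o | ∃ S, o = some S ∧ u S} =
      eventProb (iidWeight (roundLaw ρ) N) {τ |
        ∑ r, (comparisonTest C).energyStat (τ r) ≤ N * (2 * s) ∧ u (samples roundSample τ)} := by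
  refine congrArg (eventProb (iidWeight (roundLaw ρ) N)) (Set.ext fun τ => ?_)
  change (∃ S, (if ∑ r, (comparisonTest C).energyStat (τ r) ≤ N * (2 * s)
    then some (samples roundSample τ) else none) = some S ∧ u S) ↔
      ∑ r, (comparisonTest C).energyStat (τ r) ≤ N * (2 * s) ∧ u (samples roundSample τ)
  split_ifs with h <;> simp [h]

theorem energyStat_eq_zero_of_roundSample_eq_some
    {ω : EnergyCoin (n + C.length + 3) (CompQubit n) × (MsgQubit n C.length → Bool)}
    {x : Fin n → Bool} (h : roundSample ω = some x) : (comparisonTest C).energyStat ω = 0 := by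
  rw [roundSample_eq_some_iff.1 h, HistoryTest.energyStat,
    HistoryTest.penalty_timeState_zero (Set.mem_range_self x), mul_zero]

theorem samplesIID_energyVerifier (hq : advProb ρ ≠ 0) (s : ℝ) (N : ℕ) :
    (energyVerifier C s N).SamplesIID ρ (advDist ρ) := by
  intro S
  have hD (x : Fin n → Bool) : eventProb (roundLaw ρ) {ω | roundSample ω = some x} =
      eventProb (roundLaw ρ) {ω | (roundSample ω).isSome} * advDist ρ x := by
    rw [eventProb_roundSample_eq, eventProb_roundSample_isSome, advDist]
    field_simp
  have hsingle : ({some S} : Set (Option (List (Fin n → Bool)))) =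
      {o | ∃ S', o = some S' ∧ S' = S} := by
    ext o
    simp
  rw [hsingle, prob_energyVerifier, prob_energyVerifier]
  exact eventProb_samples_eq (fun ω x => energyStat_eq_zero_of_roundSample_eq_some) hD N
    (Set.Iic (N * (2 * s))) S

variable {k : ℕ} {s : ℝ} {N : ℕ} {ε : ℝ}

theorem prob_energyVerifier_isSome_le (hC : ∀ g ∈ C, g.arity ≤ k) (hρ : IsDensity ρ)
    (hs : s ∈ Set.Icc 0 1) (hE : 3 * s ≤ (comparisonTest C).energy ρ) (N : ℕ) :
    (energyVerifier C s N).prob ρ {o | o.isSome = true} ≤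
      Real.exp (-(N * (s ^ 2 /
        (4 * (22 * ((n + C.length + 3 : ℕ) + 1) * (4 * 12 ^ max k 3) ^ 2))))) := by
  have hsome : {o : Option (List (Fin n → Bool)) | o.isSome = true} =
      {o | ∃ S, o = some S ∧ True} := by
    ext o
    simp [Option.isSome_iff_exists]
  rw [hsome, prob_energyVerifier]
  simpa only [and_true] using HistoryTest.eventProb_sum_energyStat_le_le hρ
    (arity_gate_comparisonTest_le hC) hs hE N

theorem one_sub_le_prob_energyVerifier (hC : ∀ g ∈ C, g.arity ≤ k) (hρ : IsDensity ρ)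
    (hs : s ∈ Set.Icc 0 1) (hE : (comparisonTest C).energy ρ ≤ s) (hq : 0 < advProb ρ) {c : ℝ}
    (hc : c ≤ N * (advProb ρ / 4)) :
    1 - (Real.exp (-(N * (s ^ 2 /
        (4 * (22 * ((n + C.length + 3 : ℕ) + 1) * (4 * 12 ^ max k 3) ^ 2))))) +
          Real.exp (-(N * (advProb ρ / 32)))) ≤
      (energyVerifier C s N).prob ρ {o | ∃ S : List (Fin n → Bool), o = some S ∧ c ≤ S.length} := by
  have hlaw := roundLaw_mem_stdSimplex hρ
  have hsamples := eventProb_length_samples_le hlaw (roundSample (n := n) (T := C.length))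
    (by rw [eventProb_roundSample_isSome]; positivity) N
  rw [eventProb_roundSample_isSome, div_div, div_div] at hsamples
  norm_num only at hsamples
  have htest := HistoryTest.eventProb_sum_energyStat_ge_le hρ
    (arity_gate_comparisonTest_le hC) hs hE N
  rw [prob_energyVerifier, sub_le_comm, ← eventProb_compl (sum_iidWeight hlaw.2 N)]
  refine (eventProb_mono (iidWeight_nonneg hlaw.1 N) fun τ hτ => ?_).trans
    ((eventProb_union_le (iidWeight_nonneg hlaw.1 N) _ _).trans (add_le_add htest hsamples))
  rcases not_and_or.1 hτ with h | h
  · exact Or.inl (not_le.1 h).le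
  · exact Or.inr ((not_le.1 h).le.trans hc)

end EnergyVerifier

/-! ### The number of rounds -/

section Parameters

variable {η δ : ℝ}

theorem one_le_log_one_div (hδ : 0 < δ) (hδ' : δ < 1 / 3) : 1 ≤ Real.log (1 / δ) := by
  rw [Real.le_log_iff_exp_le (by positivity)]
  have h3 : 3 < 1 / δ := by
    rw [lt_div_iff₀ hδ]
    linarith
  linarith [Real.exp_one_lt_d9]

theorem exp_neg_le_half {a : ℝ} (hδ : 0 < δ) (hδ' : δ < 1 / 3) (ha : 2 * Real.log (1 / δ) ≤ a) :
    Real.exp (-a) ≤ δ / 2 :=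
  calc Real.exp (-a) ≤ Real.exp (Real.log δ + Real.log δ) := by
        rw [one_div, Real.log_inv] at ha
        exact Real.exp_le_exp.2 (by linarith)
    _ = δ * δ := by rw [Real.exp_add, Real.exp_log hδ]
    _ ≤ δ / 2 := by nlinarith

/-- The number of rounds that suffices to estimate the energy of the history states of circuits with
`m` gates, acting on at most `k` qubits each, with accuracy `(η / (m + 1)) ^ 2` and error
probability `δ`, and to collect `K` samples. -/
def numRounds (m k K : ℕ) (η δ : ℝ) : ℕ :=
  ⌈200 * (4 * 12 ^ k) ^ 2 * K * (m + 1) ^ 5 / η ^ 4 * Real.log (1 / δ)⌉₊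

theorem clock_pow_five_le {n : ℕ} (hn : 1 ≤ n) (T : ℕ) :
    ((n + T + 3 : ℕ) + 1 : ℝ) ^ 5 ≤
      50000 * ((n : ℝ) ^ 5 + (n : ℝ) ^ 2 * (T : ℝ) ^ 3 + (T : ℝ) ^ 5) := by
  have hn' : (1 : ℝ) ≤ n := by exact_mod_cast hn
  have hmixed : 0 ≤ (n : ℝ) ^ 2 * (T : ℝ) ^ 3 := by positivity
  calc ((n + T + 3 : ℕ) + 1 : ℝ) ^ 5 ≤ (5 * (n + T)) ^ 5 := by
        gcongr
        push_cast
        linarith [T.cast_nonneg (α := ℝ)]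
    _ = 5 ^ 5 * (n + T : ℝ) ^ 5 := mul_pow _ _ _
    _ ≤ 5 ^ 5 * (2 ^ (5 - 1) * ((n : ℝ) ^ 5 + (T : ℝ) ^ 5)) := by
        gcongr
        exact add_pow_le n.cast_nonneg T.cast_nonneg 5
    _ = 50000 * ((n : ℝ) ^ 5 + (T : ℝ) ^ 5) := by ring
    _ ≤ _ := by linarith

theorem numRounds_le {n K : ℕ} (hn : 1 ≤ n) (T k : ℕ) (hK : 1 ≤ K) (hη : 0 < η) (hη' : η ≤ 1)
    (hδ : 1 ≤ Real.log (1 / δ)) :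
    (numRounds (n + T + 3) k K η δ : ℝ) ≤ 20000000 * (4 * 12 ^ k) ^ 2 *
      (K * ((n : ℝ) ^ 5 + (n : ℝ) ^ 2 * (T : ℝ) ^ 3 + (T : ℝ) ^ 5) / η ^ 4 *
        Real.log (1 / δ)) := by
  set Q : ℝ := 200 * (4 * 12 ^ k) ^ 2 * K * ((n + T + 3 : ℕ) + 1) ^ 5 / η ^ 4 * Real.log (1 / δ)
    with hQ_def
  have hQ : 1 ≤ Q := by
    have hK' : (1 : ℝ) ≤ K := by exact_mod_cast hK
    have hpow : (1 : ℝ) ≤ 12 ^ k := one_le_pow₀ (by norm_num)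
    have hsq : (1 : ℝ) ≤ (4 * 12 ^ k) ^ 2 := one_le_pow₀ (by linarith)
    have hM : (1 : ℝ) ≤ ((n + T + 3 : ℕ) + 1) ^ 5 :=
      one_le_pow₀ (le_add_of_nonneg_left (Nat.cast_nonneg _))
    have hnum := one_le_mul_of_one_le_of_one_le (one_le_mul_of_one_le_of_one_le
      (one_le_mul_of_one_le_of_one_le (by norm_num : (1 : ℝ) ≤ 200) hsq) hK') hM
    refine one_le_mul_of_one_le_of_one_le ((one_le_div (by positivity)).2 ?_) hδ
    exact (pow_le_one₀ hη.le hη').trans hnum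
  calc (numRounds (n + T + 3) k K η δ : ℝ) ≤ Q + 1 := (Nat.ceil_lt_add_one (by linarith)).le
    _ ≤ 2 * Q := by linarith
    _ ≤ 2 * (200 * (4 * 12 ^ k) ^ 2 * K * (50000 * ((n : ℝ) ^ 5 + (n : ℝ) ^ 2 * (T : ℝ) ^ 3 +
          (T : ℝ) ^ 5)) / η ^ 4 * Real.log (1 / δ)) := by
        rw [hQ_def]
        gcongr
        exact clock_pow_five_le hn T
    _ = _ := by ring

theorem two_mul_log_le_numRounds_mul (m k : ℕ) {K : ℕ} (hK : 1 ≤ K) (hη : 0 < η)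
    (hδ : 0 ≤ Real.log (1 / δ)) :
    2 * Real.log (1 / δ) ≤ numRounds m k K η δ *
      (((η / (m + 1)) ^ 2) ^ 2 / (4 * (22 * (m + 1) * (4 * 12 ^ k) ^ 2))) := by
  have hK' : (1 : ℝ) ≤ K := by exact_mod_cast hK
  calc 2 * Real.log (1 / δ) ≤ 200 / 88 * (K * Real.log (1 / δ)) := by nlinarith
    _ = 200 * (4 * 12 ^ k) ^ 2 * K * (m + 1) ^ 5 / η ^ 4 * Real.log (1 / δ) *
        (((η / (m + 1)) ^ 2) ^ 2 / (4 * (22 * (m + 1) * (4 * 12 ^ k) ^ 2))) := by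
        field_simp
        ring
    _ ≤ _ := by
        gcongr
        exact Nat.le_ceil _

theorem mul_log_le_numRounds_mul (m k K : ℕ) (hη : 0 < η) (hη' : η ≤ 1)
    (hδ : 0 ≤ Real.log (1 / δ)) :
    200 * (K * Real.log (1 / δ)) ≤ numRounds m k K η δ * (m + 1 : ℝ)⁻¹ := by
  have hpow : (1 : ℝ) ≤ 12 ^ k := one_le_pow₀ (by norm_num)
  have hsq : (1 : ℝ) ≤ (4 * 12 ^ k) ^ 2 := one_le_pow₀ (by linarith)
  have hη4 : 1 ≤ (η ^ 4)⁻¹ := one_le_inv₀ (by positivity) |>.2 (pow_le_one₀ hη.le hη')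
  have hM : (1 : ℝ) ≤ (m + 1) ^ 4 := one_le_pow₀ (by simp)
  calc 200 * (K * Real.log (1 / δ))
      ≤ 200 * (K * Real.log (1 / δ)) * ((4 * 12 ^ k) ^ 2 * (m + 1) ^ 4 * (η ^ 4)⁻¹) :=
        le_mul_of_one_le_right (by positivity)
          (one_le_mul_of_one_le_of_one_le (one_le_mul_of_one_le_of_one_le hsq hM) hη4)
    _ = 200 * (4 * 12 ^ k) ^ 2 * K * (m + 1) ^ 5 / η ^ 4 * Real.log (1 / δ) * (m + 1 : ℝ)⁻¹ := by
        field_simp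
    _ ≤ _ := by
        gcongr
        exact Nat.le_ceil _

end Parameters

section ComparisonVerifier

variable {n k K : ℕ} {η δ : ℝ}

/-- The verifier of the theorem for circuits with gates on at most `k` qubits: it estimates the
energy of the messages with respect to the comparison circuit, whose own gates act on at most `3`
qubits. -/
def comparisonVerifier (C : List (Gate (Fin n))) (k K : ℕ) (η δ : ℝ) :
    Verifier (MsgQubit n C.length) n :=
  energyVerifier C ((η / ((n + C.length + 3 : ℕ) + 1)) ^ 2)
    (numRounds (n + C.length + 3) (max k 3) K η δ)

theorem sq_div_clock_mem_Icc (hη : 0 < η) (hη' : η ≤ 1) (m : ℕ) :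
    (η / (m + 1)) ^ 2 ∈ Set.Icc (0 : ℝ) 1 := by
  refine ⟨sq_nonneg _, pow_le_one₀ (by positivity) ((div_le_one (by positivity)).2 ?_)⟩
  linarith [m.cast_nonneg (α := ℝ)]

variable {C : List (Gate (Fin n))}

theorem one_sub_le_prob_comparisonVerifier (hC : ∀ g ∈ C, g.arity ≤ k) (hδ : 0 < δ)
    (hδ' : δ < 1 / 3) (hK : 1 ≤ K) (hη : 0 < η) (hη' : η ≤ 1) {D : (Fin n → Bool) → ℝ}
    (hD : D ∈ stdSimplex ℝ (Fin n → Bool)) (hDη : hellinger D (circuitDist C) ≤ η) :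
    1 - δ ≤ (comparisonVerifier C k K η δ).prob
      (pureState (historyState C (alignPhase C (qsample D))))
      {o | ∃ S : List (Fin n → Bool), o = some S ∧ (K : ℝ) ≤ S.length} := by
  have hlog := one_le_log_one_div hδ hδ'
  have hlog0 : 0 ≤ Real.log (1 / δ) := by linarith
  have hK' : (1 : ℝ) ≤ K := by exact_mod_cast hK
  have hψ := sum_norm_sq_alignPhase_qsample C hD
  have hq := advProb_historyState C hψ
  have hN := mul_log_le_numRounds_mul (n + C.length + 3) (max k 3) K hη hη' hlog0
  have htest := exp_neg_le_half hδ hδ'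
    (two_mul_log_le_numRounds_mul (n + C.length + 3) (max k 3) hK hη hlog0)
  have hsamples := exp_neg_le_half hδ hδ' (a := numRounds (n + C.length + 3) (max k 3) K η δ *
    (((n + C.length + 3 : ℕ) + 1 : ℝ)⁻¹ / 32)) (by nlinarith)
  rw [← hq] at hN hsamples
  refine le_trans ?_ (one_sub_le_prob_energyVerifier hC (isDensity_historyState C hψ)
    (sq_div_clock_mem_Icc hη hη' _) (energy_historyState_alignPhase_le C hD hDη)
    (by rw [hq]; positivity) (by nlinarith))
  linarith

theorem hellinger_circuitDist_advDist_le_of_le_prob (hC : ∀ g ∈ C, g.arity ≤ k) (hδ : 0 < δ)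
    (hδ' : δ < 1 / 3) (hK : 1 ≤ K) (hη : 0 < η) (hη' : η ≤ 1 / 100)
    {ρ : Matrix (MsgQubit n C.length → Bool) (MsgQubit n C.length → Bool) ℂ} (hρ : IsDensity ρ)
    (hV : δ ≤ (comparisonVerifier C k K η δ).prob ρ {o | o.isSome = true}) :
    0 < advProb ρ ∧ hellinger (circuitDist C) (advDist ρ) ≤ 20 * η := by
  refine hellinger_circuitDist_advDist_le hρ hη hη' (le_of_not_gt fun hE => ?_)
  have hreject := prob_energyVerifier_isSome_le hC hρ
    (sq_div_clock_mem_Icc hη (by linarith) _) hE.le (numRounds (n + C.length + 3) (max k 3) K η δ)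
  have htest := exp_neg_le_half hδ hδ' (two_mul_log_le_numRounds_mul (n + C.length + 3)
    (max k 3) hK hη (zero_le_one.trans (one_le_log_one_div hδ hδ')))
  exact absurd (hV.trans (hreject.trans htest)) (by linarith)

end ComparisonVerifier

end QVerifier

end

open QVerifier in
theorem mainTheorem4_general (k : ℕ) :
    ∃ cN > (0 : ℝ), ∀ (n : ℕ) (_ : 1 ≤ n) (C : List (Gate (Fin n))) (_ : ∀ g ∈ C, g.arity ≤ k)
        (δ : ℝ) (_ : 0 < δ) (_ : δ < 1 / 3) (K : ℕ) (_ : 1 ≤ K) (η : ℝ) (_ : 0 < η)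
        (_ : η ≤ 1 / 100),
      ∃ V : Verifier (MsgQubit n C.length) n,
        (V.rounds : ℝ) ≤ cN * (K * ((n : ℝ) ^ 5 + (n : ℝ) ^ 2 * (C.length : ℝ) ^ 3
            + (C.length : ℝ) ^ 5) / η ^ 4 * Real.log (1 / δ)) ∧
        Fintype.card (MsgQubit n C.length) ≤ 7 * (n + C.length) ∧
        (∀ D ∈ stdSimplex ℝ (Fin n → Bool), hellinger D (circuitDist C) ≤ η →
          1 - δ ≤ V.prob (pureState (historyState C (alignPhase C (qsample D))))
              {o | ∃ S : List (Fin n → Bool), o = some S ∧ (K : ℝ) ≤ S.length} ∧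
          V.SamplesIID (pureState (historyState C (alignPhase C (qsample D)))) D) ∧
        ∀ ρ : Matrix (MsgQubit n C.length → Bool) (MsgQubit n C.length → Bool) ℂ, IsDensity ρ →
          δ ≤ V.prob ρ {o | o.isSome = true} →
          0 < advProb ρ ∧ V.SamplesIID ρ (advDist ρ) ∧
          hellinger (circuitDist C) (advDist ρ) ≤ 20 * η := by
  refine ⟨20000000 * (4 * 12 ^ max k 3) ^ 2, by positivity, ?_⟩
  intro n hn C hC δ hδ hδ' K hK η hη hη'
  have hη1 : η ≤ 1 := by linarith
  refine ⟨comparisonVerifier C k K η δ,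
    numRounds_le hn _ _ hK hη hη1 (one_le_log_one_div hδ hδ'), ?_, fun D hD hDη => ⟨?_, ?_⟩,
    fun ρ hρ hV => ?_⟩
  · simp only [Fintype.card_sum, Fintype.card_fin, Fintype.card_unit]
    omega
  · exact one_sub_le_prob_comparisonVerifier hC hδ hδ' hK hη hη1 hD hDη
  · have hq := advProb_historyState C (sum_norm_sq_alignPhase_qsample C hD)
    have hiid := samplesIID_energyVerifier (hq.trans_ne (by positivity))
      ((η / ((n + C.length + 3 : ℕ) + 1)) ^ 2) (numRounds (n + C.length + 3) (max k 3) K η δ)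
    rwa [advDist_historyState_alignPhase C hD] at hiid
  · obtain ⟨hq, hdist⟩ :=
      hellinger_circuitDist_advDist_le_of_le_prob hC hδ hδ' hK hη hη' hρ hV
    exact ⟨hq, samplesIID_energyVerifier hq.ne' _ _, hdist⟩

theorem mainTheorem4 :
    ∃ η₀ > (0 : ℝ), ∃ cD > (0 : ℝ), ∃ cS > (0 : ℝ), ∀ k : ℕ, ∃ cN > (0 : ℝ),
      ∀ (n : ℕ) (_ : 1 ≤ n)
        (C : List (QVerifier.Gate (Fin n))) (_ : ∀ g ∈ C, g.arity ≤ k)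
        (δ : ℝ) (_ : 0 < δ) (_ : δ < 1 / 3) (K : ℕ) (_ : 1 ≤ K)
        (η : ℝ) (_ : 0 < η) (_ : η ≤ η₀),
      ∃ V : QVerifier.Verifier (QVerifier.MsgQubit n C.length) n,
        -- number of rounds and number of qubits per round
        (V.rounds : ℝ) ≤ cN * (K * ((n : ℝ) ^ 5 + (n : ℝ) ^ 2 * (C.length : ℝ) ^ 3
            + (C.length : ℝ) ^ 5) / η ^ 4 * Real.log (1 / δ)) ∧
        Fintype.card (QVerifier.MsgQubit n C.length) ≤ 7 * (n + C.length) ∧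
        -- completeness, for the prover that sends history states
        (∀ D ∈ stdSimplex ℝ (Fin n → Bool),
          QVerifier.hellinger D (QVerifier.circuitDist C) ≤ η →
          1 - δ ≤ V.prob
              (QVerifier.pureState
                (QVerifier.historyState C (QVerifier.alignPhase C (QVerifier.qsample D))))
              {o | ∃ S : List (Fin n → Bool), o = some S ∧ cS * (K : ℝ) ≤ (S.length : ℝ)} ∧
          V.SamplesIID
              (QVerifier.pureState
                (QVerifier.historyState C (QVerifier.alignPhase C (QVerifier.qsample D)))) D) ∧
        -- soundness, for every prover that sends a possibly mixed state
        (∀ ρ : Matrix (QVerifier.MsgQubit n C.length → Bool)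
              (QVerifier.MsgQubit n C.length → Bool) ℂ,
          QVerifier.IsDensity ρ →
          2 / 3 ≤ V.prob ρ {o | o.isSome = true} →
          0 < QVerifier.advProb ρ ∧
          V.SamplesIID ρ (QVerifier.advDist ρ) ∧
          QVerifier.hellinger (QVerifier.circuitDist C) (QVerifier.advDist ρ)
            ≤ cD * η ^ (1 / 4 : ℝ)) := by
  refine ⟨1 / 100, by norm_num, 20, by norm_num, 1, one_pos, fun k => ?_⟩
  obtain ⟨cN, hcN, hV⟩ := mainTheorem4_general k
  refine ⟨cN, hcN, fun n hn C hC δ hδ hδ' K hK η hη hη' => ?_⟩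
  obtain ⟨V, hrounds, hcard, hcomplete, hsound⟩ := hV n hn C hC δ hδ hδ' K hK η hη hη'
  refine ⟨V, hrounds, hcard, by simpa only [one_mul] using hcomplete, fun ρ hρ haccept => ?_⟩
  obtain ⟨hq, hiid, hdist⟩ := hsound ρ hρ (by linarith)
  have hη4 : η ≤ η ^ (1 / 4 : ℝ) := Real.self_le_rpow_of_le_one hη.le (by linarith) (by norm_num)
  exact ⟨hq, hiid, hdist.trans (by linarith)⟩
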